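/- Let $\mathcal A$ be a finitary abelian category, that is, $\operatorname{Hom}_{\mathcal A}(M,N)$ and $\operatorname{Ext}^1_{\mathcal A}(M,N)$ are finite sets for all objects $M,N$. Its Hall algebra $H_{\mathcal A}$ is the $\mathbb Q$-algebra with basis the isomorphism classes $[M]$ of objects and multiplication $[M][N]=\sum_{[K]}F^K_{MN}[K]$, where $F^K_{MN}$ is the number of subobjects $U\subset K$ with $U\cong N$ and $K/U\cong M$. For a full subcategory $\mathcal B$ closed under extensions (and containing $0$), $H_{\mathcal B}\subset H_{\mathcal A}$ is the subalgebra spanned by the $[M]$ with $M$ in $\mathcal B$. The algebra $H_{\mathcal A}$ is contained in its completion $\widehat H_{\mathcal A}$, which consists of the formal infinite combinations $\sum_{[M]}f_{[M]}[M]$, $f_{[M]}\in\mathbb Q$, such that each object $K$ has only finitely many subobjects $U$ with $f_{[K/U]}\ne0$, with product $(fg)_{[K]}=\sum_{U\subset K}f_{[K/U]}\,g_{[U]}$. (If all objects of $\mathcal A$ have finite length, the coefficients $f_{[M]}$ are arbitrary, and this is the completion of $H_{\mathcal A}$ with respect to the grading by the Grothendieck group.) Let $E$ be an exceptional brick in $\mathcal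 A$, that is, $\operatorname{End}_{\mathcal A}E$ is a division ring, hence a finite field, and $\operatorname{Ext}^1_{\mathcal A}(E,E)=0$. Put $q_E=|\operatorname{End}_{\mathcal A}E|$ and $[n]_q!=\prod_{k=1}^n(1+q+\dots+q^{k-1})$, and let $\operatorname{add}(E)$ be the full subcategory of direct summands of finite direct sums of copies of $E$. Let ${}^\perp\!\operatorname{add}(E)$ (respectively $\operatorname{add}(E)^\perp$) be the full subcategory of objects $C$ with $\operatorname{Ext}^1_{\mathcal A}(C,B)=0$ (respectively $\operatorname{Ext}^1_{\mathcal A}(B,C)=0$) for all $B$ in $\operatorname{add}(E)$. Let $\mathcal S_E$ be the multiplicatively closed set generated by the elements $1+(q_E-1)q_E^j[E]$, $j\in\mathbb Z$. Then $$\exp_{q_E}([E]):=\sum_{n\ge0}\frac{[E]^n}{[n]_{q_E}!}=\sum_{[M]\,:\,M\in\operatorname{add}(E)}[M]$$ is an invertible element of $\widehat H_{\mathcal A}$ (the first sum is finite in each coefficient), and for $H=H_{{}^\perp\!\operatorname{add}(E)}$ and for $H=H_{\operatorname{add}(E)^\perp}$ the following holds: (a) $\mathcal S_E$ is contained in $H$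 and is an Ore set in $H$: it contains no zero divisors of $H$, and for all $a\in H$, $s\in\mathcal S_E$ there are $u,u'\in H$ and $t,t'\in\mathcal S_E$ with $at=su$ and $t'a=u's$; (b) the inclusion $H\subset\widehat H_{\mathcal A}$ extends to an embedding of algebras $H[\mathcal S_E^{-1}]\hookrightarrow\widehat H_{\mathcal A}$, and the assignment $x\mapsto\exp_{q_E}([E])\,x\,\exp_{q_E}([E])^{-1}$ defines an algebra automorphism of $H[\mathcal S_E^{-1}]$. If moreover $E$ is projective or injective, then (a) and (b) also hold for $H=H_{\mathcal A}$. -/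

import Mathlib

open CategoryTheory CategoryTheory.Limits CategoryTheory.Abelian
open scoped ZeroObject

universe w v u

namespace HallAlgebra

section Classes

variable {A : Type u} [Category.{v} A]

variable (A) in
/-- The collection of isomorphism classes of objects. -/
def IsoClass : Type u := Quotient (isIsomorphicSetoid A)

/-- The isomorphism class `[M]` of an object. -/
def cls (M : A) : IsoClass A := Quotient.mk (isIsomorphicSetoid A) M

theorem cls_eq_iff {M N : A} : cls M = cls N ↔ Nonempty (M ≅ N) :=
  ⟨fun h => Quotient.exact h, fun h => Quotient.sound h⟩

theorem cls_eq_of_iso {M N : A} (e : M ≅ N) : cls M = cls N := cls_eq_iff.2 ⟨e⟩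

theorem exists_cls (κ : IsoClass A) : ∃ K : A, cls K = κ := Quotient.exists_rep κ

theorem cls_mk {N K : A} (f : N ⟶ K) [Mono f] : cls (Subobject.mk f : A) = cls N :=
  cls_eq_of_iso (Subobject.underlyingIso f)

end Classes

section Completion

variable {A : Type u} [Category.{v} A] [Abelian A]

/-- The quotient object `K / U`. -/
noncomputable abbrev quot {K : A} (U : Subobject K) : A := cokernel U.arrow

theorem kernelSubobject_cokernel {K : A} (U : Subobject K) :
    kernelSubobject (cokernel.π U.arrow) = U := by
  refine le_antisymm ?_ (le_kernelSubobject _ _ (cokernel.condition _))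
  refine Subobject.le_of_comm (Abelian.monoLift U.arrow _ (kernelSubobject_arrow_comp _)) ?_
  exact Abelian.monoLift_comp _ _ _

theorem cls_quot_kernel {K M : A} (p : K ⟶ M) [Epi p] :
    cls (quot (kernelSubobject p)) = cls M := by
  let e : cokernel (kernelSubobject p).arrow ≅ cokernel (kernel.ι p) :=
    cokernel.mapIso _ _ (kernelSubobjectIso p) (Iso.refl K) (by simp)
  exact cls_eq_of_iso (e ≪≫ (asIso (Abelian.factorThruCoimage p)))

theorem kernelSubobject_le_iff {K M N : A} (p : K ⟶ M) [Epi p] (q : K ⟶ N) :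
    kernelSubobject p ≤ kernelSubobject q ↔ ∃ t, p ≫ t = q := by
  constructor
  · intro h
    have h0 : kernel.ι p ≫ q = 0 := by
      have h1 : (kernelSubobject p).arrow ≫ q = 0 := by
        rw [← Subobject.ofLE_arrow h, Category.assoc, kernelSubobject_arrow_comp, comp_zero]
      rw [← kernelSubobject_arrow', Category.assoc, h1, comp_zero]
    exact ⟨Abelian.epiDesc p q h0, Abelian.comp_epiDesc _ _ _⟩
  · rintro ⟨t, rfl⟩
    exact le_kernelSubobject _ _ (by rw [← Category.assoc, kernelSubobject_arrow_comp, zero_comp])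

/-- Subobjects of `K / U` correspond to the subobjects of `K` that contain `U`. -/
noncomputable def quotEquiv {K : A} (U : Subobject K) :
    Subobject (quot U) ≃ {V : Subobject K // U ≤ V} :=
  Equiv.ofBijective
    (fun W => ⟨kernelSubobject (cokernel.π U.arrow ≫ cokernel.π W.arrow),
      le_kernelSubobject _ _ (by rw [cokernel.condition_assoc, zero_comp])⟩)
    ⟨by
      have key : ∀ W W' : Subobject (quot U),
          kernelSubobject (cokernel.π U.arrow ≫ cokernel.π W.arrow) ≤
            kernelSubobject (cokernel.π U.arrow ≫ cokernel.π W'.arrow) → W ≤ W' := by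
        intro W W' h
        obtain ⟨t, ht⟩ := (kernelSubobject_le_iff _ _).1 h
        rw [Category.assoc, cancel_epi] at ht
        rw [← kernelSubobject_cokernel W, ← kernelSubobject_cokernel W']
        exact (kernelSubobject_le_iff _ _).2 ⟨t, ht⟩
      intro W W' h
      have h' := congrArg Subtype.val h
      exact le_antisymm (key _ _ h'.le) (key _ _ h'.ge), by
      rintro ⟨V, hV⟩
      have h0 : U.arrow ≫ cokernel.π V.arrow = 0 := by
        rw [← Subobject.ofLE_arrow hV, Category.assoc, cokernel.condition, comp_zero]
      let d : quot U ⟶ quot V := cokernel.desc _ _ h0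
      have hd : cokernel.π U.arrow ≫ d = cokernel.π V.arrow := cokernel.π_desc _ _ _
      refine ⟨kernelSubobject d, Subtype.ext ?_⟩
      have : Epi (cokernel.π U.arrow ≫ d) := by rw [hd]; infer_instance
      have : Epi d := epi_of_epi (cokernel.π U.arrow) d
      have hker : kernelSubobject (cokernel.π (kernelSubobject d).arrow) = kernelSubobject d :=
        kernelSubobject_cokernel _
      obtain ⟨t, ht⟩ := (kernelSubobject_le_iff _ _).1 hker.le
      obtain ⟨s, hs⟩ := (kernelSubobject_le_iff _ _).1 hker.ge
      change kernelSubobject (cokernel.π U.arrow ≫ cokernel.π (kernelSubobject d).arrow) = V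
      conv_rhs => rw [← kernelSubobject_cokernel V, ← hd]
      apply le_antisymm
      · exact (kernelSubobject_le_iff _ _).2 ⟨t, by rw [Category.assoc, ht]⟩
      · exact (kernelSubobject_le_iff _ _).2 ⟨s, by rw [Category.assoc, hs]⟩⟩

theorem quotEquiv_coe {K : A} (U : Subobject K) (W : Subobject (quot U)) :
    (quotEquiv U W : Subobject K) =
      kernelSubobject (cokernel.π U.arrow ≫ cokernel.π W.arrow) := rfl

theorem cls_quot_quotEquiv {K : A} (U : Subobject K) (W : Subobject (quot U)) :
    cls (quot (quotEquiv U W : Subobject K)) = cls (quot W) :=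
  cls_quot_kernel _

theorem cls_subquot_quotEquiv {K : A} (U : Subobject K) (W : Subobject (quot U)) :
    cls (quot ((Subobject.pullback (quotEquiv U W : Subobject K).arrow).obj U)) = cls (W : A) := by
  set V : Subobject K := (quotEquiv U W : Subobject K) with hV
  have hVk : V = kernelSubobject (cokernel.π U.arrow ≫ cokernel.π W.arrow) := rfl
  have h0 : (V.arrow ≫ cokernel.π U.arrow) ≫ cokernel.π W.arrow = 0 := by
    rw [hVk, Category.assoc, kernelSubobject_arrow_comp]
  let p : (V : A) ⟶ (W : A) := Abelian.monoLift W.arrow _ h0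
  have hp : p ≫ W.arrow = V.arrow ≫ cokernel.π U.arrow := Abelian.monoLift_comp _ _ _
  have hepi : Epi p := by
    rw [epi_iff_surjective_up_to_refinements]
    intro T x
    obtain ⟨T', r, hr, y, hy⟩ :=
      surjective_up_to_refinements_of_epi (cokernel.π U.arrow) (x ≫ W.arrow)
    have hy0 : y ≫ (cokernel.π U.arrow ≫ cokernel.π W.arrow) = 0 := by
      rw [← Category.assoc, ← hy, Category.assoc, Category.assoc, cokernel.condition, comp_zero,
        comp_zero]
    obtain ⟨z, hz⟩ : ∃ z : T' ⟶ (V : A), z ≫ V.arrow = y :=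
      ⟨factorThruKernelSubobject _ y hy0, factorThruKernelSubobject_comp_arrow _ y hy0⟩
    refine ⟨T', r, hr, z, ?_⟩
    rw [← cancel_mono W.arrow, Category.assoc, Category.assoc, hp, hy, ← hz, Category.assoc]
  have hpb := Subobject.isPullback V.arrow U
  have hker : (Subobject.pullback V.arrow).obj U = kernelSubobject p := by
    apply le_antisymm
    · refine le_kernelSubobject _ _ ?_
      rw [← cancel_mono W.arrow, Category.assoc, hp, zero_comp, ← Category.assoc, ← hpb.w,
        Category.assoc, cokernel.condition, comp_zero]
    · have h1 : ((kernelSubobject p).arrow ≫ V.arrow) ≫ cokernel.π U.arrow = 0 := by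
        rw [Category.assoc, ← hp, ← Category.assoc, kernelSubobject_arrow_comp, zero_comp]
      refine Subobject.le_of_comm (hpb.lift (Abelian.monoLift U.arrow _ h1)
        (kernelSubobject p).arrow (Abelian.monoLift_comp _ _ _)) ?_
      exact hpb.lift_snd _ _ _
  rw [hker]
  exact cls_quot_kernel p

/-- Pull back along the inclusion of a subobject, undoing the push forward. -/
theorem pullback_subobjectOrderIso {K : A} (V : Subobject K) (U : Subobject (V : A)) :
    (Subobject.pullback V.arrow).obj (Subobject.subobjectOrderIso V U : Subobject K) = U := by
  have h : (Subobject.subobjectOrderIso V U : Subobject K) = (Subobject.map V.arrow).obj U := by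
    conv_rhs => rw [← Subobject.mk_arrow U, Subobject.map_mk]
    rfl
  rw [h, Subobject.pullback_map_self]

theorem cls_subobjectOrderIso {K : A} (V : Subobject K) (U : Subobject (V : A)) :
    cls ((Subobject.subobjectOrderIso V U : Subobject K) : A) = cls (U : A) :=
  cls_mk _

theorem cls_mapIso {K K' : A} (e : K ≅ K') (U : Subobject K) :
    cls ((Subobject.mapIsoToOrderIso e U : Subobject K') : A) = cls (U : A) ∧
      cls (quot (Subobject.mapIsoToOrderIso e U)) = cls (quot U) := by
  have h : Subobject.mapIsoToOrderIso e U = Subobject.mk (U.arrow ≫ e.hom) := by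
    rw [Subobject.mapIsoToOrderIso_apply]
    conv_lhs => rw [← Subobject.mk_arrow U, Subobject.map_mk]
  rw [h]
  exact ⟨cls_mk _, cls_eq_of_iso
    (cokernel.mapIso _ _ (Subobject.underlyingIso (U.arrow ≫ e.hom)) e.symm (by
      rw [← Subobject.underlyingIso_hom_comp_eq_mk]
      simp only [Category.assoc, Iso.symm_hom, Iso.hom_inv_id, Category.comp_id]))⟩

/-- The Hall product of two functions on isomorphism classes: the value of `f * g` at `[K]` is the
sum of `f [K / U] * g [U]` over all subobjects `U` of `K`. -/
noncomputable def hallConv (f g : IsoClass A → ℚ) : IsoClass A → ℚ :=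
  Quotient.lift (fun K : A => ∑ᶠ U : Subobject K, f (cls (quot U)) * g (cls (U : A))) (by
    rintro K K' ⟨e⟩
    rw [← finsum_comp_equiv (Subobject.mapIsoToOrderIso e).toEquiv]
    refine finsum_congr fun U => ?_
    obtain ⟨h1, h2⟩ := cls_mapIso e U
    change _ = f (cls (quot (Subobject.mapIsoToOrderIso e U))) *
      g (cls ((Subobject.mapIsoToOrderIso e U : Subobject K') : A))
    rw [h1, h2])

theorem hallConv_cls (f g : IsoClass A → ℚ) (K : A) :
    hallConv f g (cls K) = ∑ᶠ U : Subobject K, f (cls (quot U)) * g (cls (U : A)) := rfl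

/-- `f` is locally finite if every object `K` has only finitely many subobjects `U` with
`f [K / U] ≠ 0`. All sums in the Hall product `f * g` are then finite, for every function `g`. -/
def LocallyFiniteFun (f : IsoClass A → ℚ) : Prop :=
  ∀ K : A, {U : Subobject K | f (cls (quot U)) ≠ 0}.Finite

/-- If every object has only finitely many subobjects (for instance, if all objects have finite
length and all `Hom` and `Ext¹` are finite), then every function is locally finite. -/
theorem LocallyFiniteFun.of_finite_subobject (h : ∀ K : A, Finite (Subobject K))
    (f : IsoClass A → ℚ) : LocallyFiniteFun f := fun K =>
  have := h K
  Set.toFinite _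

theorem LocallyFiniteFun.hasFiniteSupport {f : IsoClass A → ℚ} (hf : LocallyFiniteFun f)
    (g : IsoClass A → ℚ) (K : A) :
    Function.HasFiniteSupport fun U : Subobject K => f (cls (quot U)) * g (cls (U : A)) :=
  (hf K).subset fun _ hU => left_ne_zero_of_mul hU

/-- The function on pairs of subobjects of `K` that underlies associativity. -/
noncomputable def flagFun (f g h : IsoClass A → ℚ) (K : A) (x : Subobject K × Subobject K) : ℚ :=
  open Classical in
  if x.1 ≤ x.2 then
    f (cls (quot x.2)) * g (cls (quot ((Subobject.pullback x.2.arrow).obj x.1))) *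
      h (cls (x.1 : A)) else 0

theorem flagFun_of_le (f g h : IsoClass A → ℚ) {K : A} {U V : Subobject K} (hUV : U ≤ V) :
    flagFun f g h K (U, V) =
      f (cls (quot V)) * g (cls (quot ((Subobject.pullback V.arrow).obj U))) * h (cls (U : A)) :=
  if_pos hUV

theorem flagFun_of_not_le (f g h : IsoClass A → ℚ) {K : A} {U V : Subobject K} (hUV : ¬ U ≤ V) :
    flagFun f g h K (U, V) = 0 :=
  if_neg hUV

theorem flagFun_finite {f g : IsoClass A → ℚ} (hf : LocallyFiniteFun f) (hg : LocallyFiniteFun g)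
    (h : IsoClass A → ℚ) (K : A) : Function.HasFiniteSupport (flagFun f g h K) := by
  have : (⋃ V ∈ {V : Subobject K | f (cls (quot V)) ≠ 0},
      (fun U : Subobject (V : A) => ((Subobject.subobjectOrderIso V U : Subobject K), V)) ''
        {U | g (cls (quot U)) ≠ 0}).Finite :=
    (hf K).biUnion fun V _ => (hg _).image _
  refine this.subset ?_
  rintro ⟨U, V⟩ hx
  have hUV : U ≤ V := by
    by_contra hc
    exact hx (flagFun_of_not_le _ _ _ hc)
  have hx' : f (cls (quot V)) * g (cls (quot ((Subobject.pullback V.arrow).obj U))) *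
      h (cls (U : A)) ≠ 0 := by
    have : flagFun f g h K (U, V) ≠ 0 := hx
    rwa [flagFun_of_le _ _ _ hUV] at this
  obtain ⟨U', hU'⟩ := (Subobject.subobjectOrderIso V).surjective ⟨U, hUV⟩
  have hU'' : (Subobject.subobjectOrderIso V U' : Subobject K) = U := by rw [hU']
  refine Set.mem_biUnion (left_ne_zero_of_mul (left_ne_zero_of_mul hx')) ⟨U', ?_, ?_⟩
  · have := right_ne_zero_of_mul (left_ne_zero_of_mul hx')
    rwa [← hU'', pullback_subobjectOrderIso] at this
  · simp only [hU'']

theorem finsum_flagFun_right (f g h : IsoClass A → ℚ) (K : A) (V : Subobject K) :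
    ∑ᶠ U, flagFun f g h K (U, V) =
      ∑ᶠ U : Subobject (V : A), f (cls (quot V)) * (g (cls (quot U)) * h (cls (U : A))) := by
  classical
  have h1 : ∀ U, flagFun f g h K (U, V) = ∑ᶠ _ : U ∈ Set.Iic V, flagFun f g h K (U, V) := by
    intro U
    by_cases hU : U ≤ V
    · rw [finsum_eq_if]; exact (if_pos hU).symm
    · rw [finsum_eq_if, flagFun_of_not_le _ _ _ hU, ite_self]
  rw [finsum_congr h1, ← finsum_set_coe_eq_finsum_mem,
    ← finsum_comp_equiv (Subobject.subobjectOrderIso V).toEquiv]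
  refine finsum_congr fun U => ?_
  change flagFun f g h K ((Subobject.subobjectOrderIso V U : Subobject K), V) = _
  rw [flagFun_of_le _ _ _ (Subobject.subobjectOrderIso V U).2, pullback_subobjectOrderIso,
    cls_subobjectOrderIso, mul_assoc]

theorem finsum_flagFun_left (f g h : IsoClass A → ℚ) (K : A) (U : Subobject K) :
    ∑ᶠ V, flagFun f g h K (U, V) =
      ∑ᶠ W : Subobject (quot U), f (cls (quot W)) * g (cls (W : A)) * h (cls (U : A)) := by
  classical
  have h1 : ∀ V, flagFun f g h K (U, V) =
      ∑ᶠ _ : V ∈ {V : Subobject K | U ≤ V}, flagFun f g h K (U, V) := by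
    intro V
    by_cases hU : U ≤ V
    · rw [finsum_eq_if]; exact (if_pos hU).symm
    · rw [finsum_eq_if, flagFun_of_not_le _ _ _ hU, ite_self]
  rw [finsum_congr h1, ← finsum_set_coe_eq_finsum_mem]
  refine (finsum_comp_equiv (quotEquiv U)).symm.trans ?_
  refine finsum_congr fun W => ?_
  change flagFun f g h K (U, (quotEquiv U W : Subobject K)) = _
  rw [flagFun_of_le _ _ _ (quotEquiv U W).2, cls_quot_quotEquiv, cls_subquot_quotEquiv]

theorem LocallyFiniteFun.hallConv {f g : IsoClass A → ℚ} (hf : LocallyFiniteFun f)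
    (hg : LocallyFiniteFun g) : LocallyFiniteFun (hallConv f g) := by
  intro K
  have hfin := flagFun_finite hf hg 1 K
  refine (hfin.image Prod.fst).subset ?_
  intro U hU
  obtain ⟨W, hW⟩ : ∃ W : Subobject (quot U), f (cls (quot W)) * g (cls (W : A)) ≠ 0 := by
    by_contra! hc
    exact hU ((finsum_congr hc).trans finsum_zero)
  refine ⟨(U, (quotEquiv U W : Subobject K)), ?_, rfl⟩
  rw [Function.mem_support, flagFun_of_le _ _ _ (quotEquiv U W).2, cls_quot_quotEquiv,
    cls_subquot_quotEquiv]
  simpa using hW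

theorem hallConv_assoc {f g : IsoClass A → ℚ} (hf : LocallyFiniteFun f) (hg : LocallyFiniteFun g)
    (h : IsoClass A → ℚ) : hallConv (hallConv f g) h = hallConv f (hallConv g h) := by
  funext κ
  obtain ⟨K, rfl⟩ := exists_cls κ
  have hfin := flagFun_finite hf hg h K
  have hfin' : Function.HasFiniteSupport
      (fun x : Subobject K × Subobject K => flagFun f g h K x.swap) :=
    hfin.preimage (Prod.swap_injective.injOn)
  have e1 : hallConv (hallConv f g) h (cls K) = ∑ᶠ U, ∑ᶠ V, flagFun f g h K (U, V) := by
    rw [hallConv_cls]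
    refine finsum_congr fun U => ?_
    rw [finsum_flagFun_left, hallConv_cls, finsum_mul]
  have e2 : hallConv f (hallConv g h) (cls K) = ∑ᶠ V, ∑ᶠ U, flagFun f g h K (U, V) := by
    rw [hallConv_cls]
    refine finsum_congr fun V => ?_
    rw [finsum_flagFun_right, hallConv_cls, mul_finsum]
  rw [e1, e2, ← finsum_curry _ hfin]
  exact (finsum_comp_equiv (Equiv.prodComm (Subobject K) (Subobject K))).symm.trans
    (finsum_curry (fun x : Subobject K × Subobject K => flagFun f g h K x.swap) hfin')

variable (A) in
/-- The completed Hall algebra: all locally finite functions on isomorphism classes. -/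
noncomputable def completedSubmodule : Submodule ℚ (IsoClass A → ℚ) where
  carrier := {f | LocallyFiniteFun f}
  zero_mem' K := by simp
  add_mem' {f g} hf hg K := ((hf K).union (hg K)).subset fun U hU => by
    by_contra hc
    simp only [Set.mem_union, Set.mem_ofPred_eq, not_or, not_not] at hc
    exact hU (by rw [Pi.add_apply, hc.1, hc.2, add_zero])
  smul_mem' c f hf K := (hf K).subset fun U hU => right_ne_zero_of_mul hU

variable (A) in
/-- The completed Hall algebra, a `ℚ`-algebra under the Hall product. A function is thought of as
the formal infinite linear combination of the classes `[M]` with the given coefficients. -/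
def CompletedHall : Type u := completedSubmodule A

namespace CompletedHall

noncomputable instance : AddCommGroup (CompletedHall A) :=
  inferInstanceAs (AddCommGroup (completedSubmodule A))

noncomputable instance : Module ℚ (CompletedHall A) :=
  inferInstanceAs (Module ℚ (completedSubmodule A))

/-- The coefficient of an element at an isomorphism class. -/
def coeff (x : CompletedHall A) : IsoClass A → ℚ := x.1

theorem locallyFinite (x : CompletedHall A) : LocallyFiniteFun x.coeff := x.2

@[ext]
theorem ext {x y : CompletedHall A} (h : x.coeff = y.coeff) : x = y := Subtype.ext h

@[simp] theorem coeff_add (x y : CompletedHall A) : (x + y).coeff = x.coeff + y.coeff := rfl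
@[simp] theorem coeff_zero : (0 : CompletedHall A).coeff = 0 := rfl
@[simp] theorem coeff_smul (c : ℚ) (x : CompletedHall A) : (c • x).coeff = c • x.coeff := rfl

noncomputable instance : Mul (CompletedHall A) :=
  ⟨fun x y => ⟨hallConv x.coeff y.coeff, x.locallyFinite.hallConv y.locallyFinite⟩⟩

theorem coeff_mul (x y : CompletedHall A) : (x * y).coeff = hallConv x.coeff y.coeff := rfl

theorem coeff_mul_cls (x y : CompletedHall A) (K : A) :
    (x * y).coeff (cls K) =
      ∑ᶠ U : Subobject K, x.coeff (cls (quot U)) * y.coeff (cls (U : A)) := rfl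

end CompletedHall

theorem isZero_quot_iff {K : A} (U : Subobject K) : cls (quot U) = cls (0 : A) ↔ U = ⊤ := by
  rw [cls_eq_iff, ← Subobject.isIso_arrow_iff_eq_top]
  constructor
  · rintro ⟨e⟩
    have h0 : cokernel.π U.arrow = 0 := (IsZero.of_iso (isZero_zero A) e).eq_of_tgt _ _
    have := Preadditive.epi_of_cokernel_zero h0
    exact isIso_of_mono_of_epi _
  · intro h
    exact ⟨(isZero_cokernel_of_epi U.arrow).iso (isZero_zero A)⟩

theorem isZero_coe_iff {K : A} (U : Subobject K) : cls (U : A) = cls (0 : A) ↔ U = ⊥ := by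
  rw [cls_eq_iff]
  constructor
  · rintro ⟨e⟩
    have h0 : U.arrow = 0 := (IsZero.of_iso (isZero_zero A) e).eq_of_src _ _
    rw [← Subobject.mk_arrow U, Subobject.mk_eq_bot_iff_zero]
    exact h0
  · rintro rfl
    exact ⟨Subobject.botCoeIsoZero⟩

namespace CompletedHall

open Classical in
noncomputable instance : One (CompletedHall A) :=
  ⟨⟨fun κ => if κ = cls (0 : A) then 1 else 0, fun K =>
    (Set.finite_singleton (⊤ : Subobject K)).subset fun U hU => by
      by_contra hc
      exact hU (if_neg fun h => hc ((isZero_quot_iff U).1 h))⟩⟩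

open Classical in
theorem coeff_one (κ : IsoClass A) :
    (1 : CompletedHall A).coeff κ = if κ = cls (0 : A) then 1 else 0 := rfl

noncomputable instance : Ring (CompletedHall A) :=
  { (inferInstance : AddCommGroup (CompletedHall A)),
    (inferInstance : Mul (CompletedHall A)),
    (inferInstance : One (CompletedHall A)) with
    mul_assoc := fun x y z => ext (hallConv_assoc x.locallyFinite y.locallyFinite z.coeff)
    one_mul := fun x => by
      ext κ
      obtain ⟨K, rfl⟩ := exists_cls κ
      rw [coeff_mul_cls, finsum_eq_single _ ⊤]
      · rw [coeff_one, if_pos ((isZero_quot_iff _).2 rfl), one_mul]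
        exact congrArg x.coeff (cls_eq_of_iso (asIso (⊤ : Subobject K).arrow))
      · intro U hU
        rw [coeff_one, if_neg (fun h => hU ((isZero_quot_iff _).1 h)), zero_mul]
    mul_one := fun x => by
      ext κ
      obtain ⟨K, rfl⟩ := exists_cls κ
      rw [coeff_mul_cls, finsum_eq_single _ ⊥]
      · rw [coeff_one, if_pos ((isZero_coe_iff _).2 rfl), mul_one]
        have : (⊥ : Subobject K).arrow = 0 := Subobject.bot_arrow
        exact congrArg x.coeff (cls_eq_of_iso (cokernelIsoOfEq this ≪≫ cokernelZeroIsoTarget))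
      · intro U hU
        rw [coeff_one, if_neg (fun h => hU ((isZero_coe_iff _).1 h)), mul_zero]
    left_distrib := fun x y z => by
      ext κ
      obtain ⟨K, rfl⟩ := exists_cls κ
      rw [coeff_add, Pi.add_apply, coeff_mul_cls, coeff_mul_cls, coeff_mul_cls,
        ← finsum_add_distrib (x.locallyFinite.hasFiniteSupport _ K)
          (x.locallyFinite.hasFiniteSupport _ K)]
      exact finsum_congr fun U => mul_add _ _ _
    right_distrib := fun x y z => by
      ext κ
      obtain ⟨K, rfl⟩ := exists_cls κ
      rw [coeff_add, Pi.add_apply, coeff_mul_cls, coeff_mul_cls, coeff_mul_cls,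
        ← finsum_add_distrib (x.locallyFinite.hasFiniteSupport _ K)
          (y.locallyFinite.hasFiniteSupport _ K)]
      exact finsum_congr fun U => add_mul _ _ _
    zero_mul := fun x => by
      ext κ
      obtain ⟨K, rfl⟩ := exists_cls κ
      rw [coeff_mul_cls]
      exact (finsum_congr fun U => zero_mul _).trans finsum_zero
    mul_zero := fun x => by
      ext κ
      obtain ⟨K, rfl⟩ := exists_cls κ
      rw [coeff_mul_cls]
      exact (finsum_congr fun U => mul_zero _).trans finsum_zero }

noncomputable instance : Algebra ℚ (CompletedHall A) :=
  Algebra.ofModule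
    (fun c x y => by
      ext κ
      obtain ⟨K, rfl⟩ := exists_cls κ
      rw [coeff_smul, Pi.smul_apply, coeff_mul_cls, coeff_mul_cls, smul_eq_mul, mul_finsum]
      exact finsum_congr fun U => mul_assoc _ _ _)
    (fun c x y => by
      ext κ
      obtain ⟨K, rfl⟩ := exists_cls κ
      rw [coeff_smul, Pi.smul_apply, coeff_mul_cls, coeff_mul_cls, smul_eq_mul, mul_finsum]
      exact finsum_congr fun U => mul_left_comm _ _ _)

end CompletedHall

end Completion

/-- All sets of morphisms are finite. -/
class HomFinite (A : Type u) [Category.{v} A] : Prop where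
  finite_hom (M N : A) : Finite (M ⟶ N)

/-- All groups `Ext¹` are finite. -/
class ExtFinite (A : Type u) [Category.{v} A] [Abelian A] [HasExt.{w} A] : Prop where
  finite_ext (M N : A) : Finite (Ext.{w} M N 1)

attribute [instance] HomFinite.finite_hom ExtFinite.finite_ext

section Elements

variable {A : Type u} [Category.{v} A] [Abelian A]

theorem eq_of_vanishing {K : A} {U V : Subobject K} {X : A} (p : K ⟶ X)
    (hU : kernelSubobject p = U) (hV : V.arrow ≫ p = 0) : V ≤ U :=
  hU ▸ le_kernelSubobject _ _ hV

theorem finite_quot_iso [HomFinite A] (K M : A) :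
    {U : Subobject K | cls (quot U) = cls M}.Finite := by
  have hex : ∀ U : {U : Subobject K | cls (quot U) = cls M},
      ∃ p : K ⟶ M, kernelSubobject p = U.1 := by
    rintro ⟨U, hU⟩
    obtain ⟨e⟩ := cls_eq_iff.1 hU
    exact ⟨cokernel.π U.arrow ≫ e.hom, by
      rw [kernelSubobject_comp_mono, kernelSubobject_cokernel]⟩
  choose p hp using hex
  have hinj : Function.Injective p := fun U V h => Subtype.ext (by rw [← hp U, ← hp V, h])
  exact Set.finite_coe_iff.1 (Finite.of_injective p hinj)

theorem LocallyFiniteFun.of_finite [HomFinite A] {f : IsoClass A → ℚ}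
    (hf : {κ | f κ ≠ 0}.Finite) : LocallyFiniteFun f := by
  intro K
  have : (⋃ κ ∈ {κ | f κ ≠ 0}, {U : Subobject K | cls (quot U) = κ}).Finite := by
    refine hf.biUnion fun κ _ => ?_
    obtain ⟨M, rfl⟩ := exists_cls κ
    exact finite_quot_iso K M
  exact this.subset fun U hU => Set.mem_biUnion (x := cls (quot U)) hU rfl

open Classical in
/-- The basis element `[M]` of the Hall algebra. -/
noncomputable def basisElt [HomFinite A] (M : A) : CompletedHall A :=
  ⟨fun κ => if κ = cls M then 1 else 0, LocallyFiniteFun.of_finite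
    (f := fun κ => if κ = cls M then 1 else 0)
    ((Set.finite_singleton (cls M)).subset fun κ (hκ : (if κ = cls M then (1 : ℚ) else 0) ≠ 0) => by
      by_contra hc
      exact hκ (if_neg hc))⟩

/-- The structure constants of the basis `[M]` are the Hall numbers: the coefficient of `[K]` in
`[M] * [N]` is the number of subobjects `U` of `K` with `U ≅ N` and `K / U ≅ M`. -/
theorem coeff_basisElt_mul [HomFinite A] (M N K : A) :
    (basisElt M * basisElt N).coeff (cls K) =
      Nat.card {U : Subobject K // Nonempty ((U : A) ≅ N) ∧ Nonempty (quot U ≅ M)} := by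
  classical
  have hfin : {U : Subobject K | Nonempty ((U : A) ≅ N) ∧ Nonempty (quot U ≅ M)}.Finite :=
    (finite_quot_iso K M).subset fun U hU => cls_eq_iff.2 hU.2
  rw [CompletedHall.coeff_mul_cls]
  have h1 : ∀ U : Subobject K,
      (basisElt M).coeff (cls (quot U)) * (basisElt N).coeff (cls (U : A)) =
        ∑ᶠ _ : U ∈ {U : Subobject K | Nonempty ((U : A) ≅ N) ∧ Nonempty (quot U ≅ M)},
          (1 : ℚ) := by
    intro U
    rw [finsum_eq_if]
    change (if cls (quot U) = cls M then (1 : ℚ) else 0) *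
      (if cls (U : A) = cls N then (1 : ℚ) else 0) = _
    simp only [cls_eq_iff, Set.mem_ofPred_eq]
    split_ifs <;> simp_all
  rw [finsum_congr h1, finsum_mem_eq_finite_toFinset_sum _ hfin, Finset.sum_const, nsmul_eq_mul,
    mul_one]
  have := Nat.card_eq_card_finite_toFinset hfin
  rw [← this]
  rfl

attribute [local instance] Abelian.hasFiniteBiproducts

/-- `add E`: direct summands of finite direct sums of copies of `E`. -/
def addClosure (E : A) : ObjectProperty A := fun M =>
  ∃ n : ℕ, Nonempty (Retract M (⨁ fun _ : Fin n => E))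

theorem finite_quot_addClosure [HomFinite A] (E K : A) :
    {U : Subobject K | ∃ M, cls M = cls (quot U) ∧ addClosure E M}.Finite := by
  have key : ∀ U V : Subobject K, (∃ M, cls M = cls (quot U) ∧ addClosure E M) →
      (∀ p : K ⟶ E, U.arrow ≫ p = 0 → V.arrow ≫ p = 0) → V ≤ U := by
    rintro U V ⟨M, hM, n, ⟨r⟩⟩ h
    obtain ⟨e⟩ := cls_eq_iff.1 hM
    have hr : Mono (e.inv ≫ r.i) := inferInstance
    rw [← kernelSubobject_cokernel U, ← kernelSubobject_comp_mono _ (e.inv ≫ r.i)]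
    refine le_kernelSubobject _ _ (biproduct.hom_ext _ _ fun j => ?_)
    rw [zero_comp, Category.assoc]
    exact h ((cokernel.π U.arrow ≫ e.inv ≫ r.i) ≫ biproduct.π _ j) (by
      rw [Category.assoc, cokernel.condition_assoc, zero_comp])
  let φ : {U : Subobject K | ∃ M, cls M = cls (quot U) ∧ addClosure E M} → Set (K ⟶ E) :=
    fun U => {p | U.1.arrow ≫ p = 0}
  have hinj : Function.Injective φ := by
    intro U V h
    have h' : ∀ p : K ⟶ E, U.1.arrow ≫ p = 0 ↔ V.1.arrow ≫ p = 0 := fun p => by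
      have := Set.ext_iff.1 h p
      exact this
    exact Subtype.ext (le_antisymm (key _ _ V.2 fun p => (h' p).2) (key _ _ U.2 fun p => (h' p).1))
  exact Set.finite_coe_iff.1 (Finite.of_injective φ hinj)

open Classical in
/-- The exponential of the subcategory `add E`: the sum of all `[M]` with `M` in `add E`. -/
noncomputable def expAdd [HomFinite A] (E : A) : CompletedHall A :=
  ⟨fun κ => if ∃ M, cls M = κ ∧ addClosure E M then 1 else 0, fun K =>
    (finite_quot_addClosure E K).subset fun U hU => by
      by_contra hc
      exact hU (if_neg hc)⟩

/-- The `q`-factorial `[n]_q! = ∏_{k=1}^n (1 + q + ⋯ + q^(k-1))`. -/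
noncomputable def qFactorial (q : ℚ) (n : ℕ) : ℚ :=
  ∏ k ∈ Finset.range n, ∑ i ∈ Finset.range (k + 1), q ^ i

end Elements

section Subalgebra

variable {A : Type u} [Category.{v} A] [Abelian A]

theorem iso_of_extClass_eq [HasExt.{w} A] {N K K' M : A} {f : N ⟶ K} {g : K ⟶ M} {f' : N ⟶ K'}
    {g' : K' ⟶ M} {zero : f ≫ g = 0} {zero' : f' ≫ g' = 0}
    (h : (ShortComplex.mk f g zero).ShortExact) (h' : (ShortComplex.mk f' g' zero').ShortExact)
    (he : (h.extClass : Ext.{w} M N 1) = h'.extClass) : Nonempty (K ≅ K') := by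
  obtain ⟨x, hx⟩ := Ext.contravariant_sequence_exact₁ h _ (Ext.mk₀ f') (add_zero 1)
    (by rw [he]; exact h'.extClass_comp)
  obtain ⟨t, rfl⟩ := (Ext.mk₀_bijective _ _).2 x
  rw [Ext.mk₀_comp_mk₀] at hx
  have ht : f ≫ t = f' := (Ext.mk₀_bijective _ _).1 hx
  have hepi : Epi g := h.epi_g
  have hmono' : Mono f' := h'.mono_f
  have h0 : f ≫ t ≫ g' = 0 := by rw [← Category.assoc, ht, zero']
  let e : M ⟶ M := h.exact.desc (t ≫ g') h0
  have hge : g ≫ e = t ≫ g' := h.exact.g_desc _ _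
  have hnat := ShortComplex.ShortExact.extClass_naturality (h₁ := h) (h₂ := h')
    { τ₁ := 𝟙 N, τ₂ := t, τ₃ := e, comm₁₂ := by simp [ht], comm₂₃ := by simpa using hge.symm }
  dsimp at hnat
  rw [Ext.comp_mk₀_id, he] at hnat
  have h1 : (Ext.mk₀ (𝟙 M - e)).comp h'.extClass (zero_add 1) = 0 := by
    rw [sub_eq_add_neg, Ext.mk₀_add, Ext.mk₀_neg, Ext.add_comp, Ext.neg_comp, ← hnat,
      Ext.mk₀_id_comp, add_neg_cancel]
  obtain ⟨y, hy⟩ := Ext.covariant_sequence_exact₃ _ h' (Ext.mk₀ (𝟙 M - e)) (zero_add 1) h1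
  obtain ⟨l, rfl⟩ := (Ext.mk₀_bijective _ _).2 y
  rw [Ext.mk₀_comp_mk₀] at hy
  have hl : l ≫ g' = 𝟙 M - e := (Ext.mk₀_bijective _ _).1 hy
  let φ : ShortComplex.mk f g zero ⟶ ShortComplex.mk f' g' zero' :=
    { τ₁ := 𝟙 N, τ₂ := t + g ≫ l, τ₃ := 𝟙 M
      comm₁₂ := by
        simp only [Preadditive.comp_add, ht, Category.id_comp]
        rw [← Category.assoc, zero, zero_comp, add_zero]
      comm₂₃ := by
        simp only [Preadditive.add_comp, Category.assoc, hl, Category.comp_id, Preadditive.comp_sub,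
          hge]
        abel }
  have h1 : IsIso φ.τ₁ := inferInstanceAs (IsIso (𝟙 N))
  have h3 : IsIso φ.τ₃ := inferInstanceAs (IsIso (𝟙 M))
  have : IsIso φ.τ₂ := ShortComplex.isIso₂_of_shortExact_of_isIso₁₃ φ h h'
  exact ⟨asIso φ.τ₂⟩

/-- `K` is an extension of `M` by `N`, that is there is an exact `0 ⟶ N ⟶ K ⟶ M ⟶ 0`. -/
def IsExtension (M N K : A) : Prop :=
  ∃ (f : N ⟶ K) (g : K ⟶ M) (zero : f ≫ g = 0), (ShortComplex.mk f g zero).ShortExact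

theorem isExtension_of_cls {K M N : A} (U : Subobject K) (hN : cls (U : A) = cls N)
    (hM : cls (quot U) = cls M) : IsExtension M N K := by
  obtain ⟨i⟩ := cls_eq_iff.1 hN
  obtain ⟨e⟩ := cls_eq_iff.1 hM
  have h : (ShortComplex.mk U.arrow (cokernel.π U.arrow) (cokernel.condition _)).ShortExact :=
    { exact := ShortComplex.exact_cokernel _ }
  have zero : (i.inv ≫ U.arrow) ≫ (cokernel.π U.arrow ≫ e.hom) = 0 := by
    rw [Category.assoc, cokernel.condition_assoc, zero_comp, comp_zero]
  exact ⟨i.inv ≫ U.arrow, cokernel.π U.arrow ≫ e.hom, zero,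
    ShortComplex.shortExact_of_iso (ShortComplex.isoMk i (Iso.refl K) e) h⟩

theorem finite_isExtension [HasExt.{w} A] [ExtFinite.{w} A] (M N : A) :
    {κ : IsoClass A | ∃ K, cls K = κ ∧ IsExtension M N K}.Finite := by
  have hex : ∀ κ : {κ : IsoClass A | ∃ K, cls K = κ ∧ IsExtension M N K},
      ∃ (x : Ext.{w} M N 1) (K : A) (_ : cls K = κ.1) (f : N ⟶ K) (g : K ⟶ M) (zero : f ≫ g = 0)
        (h : (ShortComplex.mk f g zero).ShortExact), x = h.extClass := by
    rintro ⟨κ, K, hK, f, g, zero, h⟩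
    exact ⟨h.extClass, K, hK, f, g, zero, h, rfl⟩
  choose x K hK f g zero h hx using hex
  have hinj : Function.Injective x := fun κ κ' hh => Subtype.ext (by
    rw [← hK κ, ← hK κ']
    exact cls_eq_iff.2 (iso_of_extClass_eq (h κ) (h κ') (by rw [← hx, ← hx, hh])))
  exact Set.finite_coe_iff.1 (Finite.of_injective x hinj)

/-- The Hall algebra of the full subcategory `P`, which is closed under extensions and contains
the zero object: the subalgebra of all finite linear combinations of the `[M]` with `M` in `P`. -/
noncomputable def hallSubalgebra [HomFinite A] [HasExt.{w} A] [ExtFinite.{w} A]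
    (P : ObjectProperty A) [P.IsClosedUnderIsomorphisms] [P.ContainsZero]
    [P.IsClosedUnderExtensions] : Subalgebra ℚ (CompletedHall A) where
  carrier := {x | {κ | x.coeff κ ≠ 0}.Finite ∧ ∀ M : A, x.coeff (cls M) ≠ 0 → P M}
  add_mem' := by
    rintro x y ⟨hx, hx'⟩ ⟨hy, hy'⟩
    have key : ∀ κ, (x + y).coeff κ ≠ 0 → x.coeff κ ≠ 0 ∨ y.coeff κ ≠ 0 := by
      intro κ hκ
      by_contra! hc
      exact hκ (by rw [CompletedHall.coeff_add, Pi.add_apply, hc.1, hc.2, add_zero])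
    exact ⟨(hx.union hy).subset fun κ hκ => key κ hκ,
      fun M hM => (key _ hM).elim (hx' M) (hy' M)⟩
  mul_mem' := by
    rintro x y ⟨hx, hx'⟩ ⟨hy, hy'⟩
    have key : ∀ K : A, (x * y).coeff (cls K) ≠ 0 → ∃ M N : A, x.coeff (cls M) ≠ 0 ∧
        y.coeff (cls N) ≠ 0 ∧ ∃ U : Subobject K, cls (U : A) = cls N ∧ cls (quot U) = cls M := by
      intro K hK
      by_contra! hc
      refine hK ?_
      rw [CompletedHall.coeff_mul_cls]
      refine (finsum_congr fun U => ?_).trans finsum_zero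
      by_contra hU
      exact hc _ _ (left_ne_zero_of_mul hU) (right_ne_zero_of_mul hU) U rfl rfl
    refine ⟨?_, fun K hK => ?_⟩
    · have : (⋃ μ ∈ {κ | x.coeff κ ≠ 0}, ⋃ ν ∈ {κ | y.coeff κ ≠ 0},
          {κ : IsoClass A | ∃ M N K : A, cls M = μ ∧ cls N = ν ∧ cls K = κ ∧
            IsExtension M N K}).Finite := by
        refine hx.biUnion fun μ _ => hy.biUnion fun ν _ => ?_
        obtain ⟨M, rfl⟩ := exists_cls μ
        obtain ⟨N, rfl⟩ := exists_cls ν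
        refine (finite_isExtension M N).subset ?_
        rintro κ ⟨M', N', K, hM, hN, hK, f, g, zero, h⟩
        obtain ⟨e⟩ := cls_eq_iff.1 hM
        obtain ⟨i⟩ := cls_eq_iff.1 hN
        have zero' : (i.inv ≫ f) ≫ (g ≫ e.hom) = 0 := by
          rw [Category.assoc, ← Category.assoc f, zero, zero_comp, comp_zero]
        exact ⟨K, hK, i.inv ≫ f, g ≫ e.hom, zero',
          ShortComplex.shortExact_of_iso (ShortComplex.isoMk i (Iso.refl K) e) h⟩
      refine this.subset fun κ hκ => ?_
      obtain ⟨K, rfl⟩ := exists_cls κ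
      obtain ⟨M, N, hM, hN, U, hU, hU'⟩ := key K hκ
      exact Set.mem_biUnion (x := cls M) hM (Set.mem_biUnion (x := cls N) hN
        ⟨M, N, K, rfl, rfl, rfl, isExtension_of_cls U hU hU'⟩)
    · obtain ⟨M, N, hM, hN, U, hU, hU'⟩ := key K hK
      obtain ⟨f, g, zero, h⟩ := isExtension_of_cls U hU hU'
      exact P.prop_X₂_of_shortExact h (hy' N hN) (hx' M hM)
  algebraMap_mem' c := by
    have key : ∀ κ, (algebraMap ℚ (CompletedHall A) c).coeff κ ≠ 0 → κ = cls (0 : A) := by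
      intro κ hκ
      by_contra hc
      rw [Algebra.algebraMap_eq_smul_one, CompletedHall.coeff_smul, Pi.smul_apply,
        CompletedHall.coeff_one, if_neg hc, smul_zero] at hκ
      exact hκ rfl
    refine ⟨(Set.finite_singleton (cls (0 : A))).subset key, fun M hM => ?_⟩
    obtain ⟨e⟩ := cls_eq_iff.1 (key _ hM)
    exact P.prop_of_iso e.symm P.prop_zero

variable [HasExt.{w} A]

/-- The objects `C` with `Ext¹(B, C) = 0` for all `B` in `P`. -/
def rightOrth (P : ObjectProperty A) : ObjectProperty A := fun C =>
  ∀ B, P B → Subsingleton (Ext.{w} B C 1)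

/-- The objects `C` with `Ext¹(C, B) = 0` for all `B` in `P`. -/
def leftOrth (P : ObjectProperty A) : ObjectProperty A := fun C =>
  ∀ B, P B → Subsingleton (Ext.{w} C B 1)

instance (P : ObjectProperty A) : (rightOrth.{w} P).IsClosedUnderExtensions where
  prop_X₂_of_shortExact {S} hS h₁ h₃ B hB := by
    have := h₁ B hB
    have := h₃ B hB
    refine subsingleton_of_forall_eq 0 fun x => ?_
    obtain ⟨y, rfl⟩ := Ext.covariant_sequence_exact₂ B hS x (Subsingleton.elim _ _)
    rw [Subsingleton.elim y 0, Ext.zero_comp]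

instance (P : ObjectProperty A) : (leftOrth.{w} P).IsClosedUnderExtensions where
  prop_X₂_of_shortExact {S} hS h₁ h₃ B hB := by
    have := h₁ B hB
    have := h₃ B hB
    refine subsingleton_of_forall_eq 0 fun x => ?_
    obtain ⟨y, rfl⟩ := Ext.contravariant_sequence_exact₂ hS B x (Subsingleton.elim _ _)
    rw [Subsingleton.elim y 0, Ext.comp_zero]

instance (P : ObjectProperty A) : (rightOrth.{w} P).IsClosedUnderIsomorphisms where
  of_iso {X Y} e hX B hB := by
    have := hX B hB
    refine subsingleton_of_forall_eq 0 fun x => ?_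
    have h : (x.comp (Ext.mk₀ e.inv) (add_zero 1)).comp (Ext.mk₀ e.hom) (add_zero 1) = x := by
      simp
    rw [← h, Subsingleton.elim (x.comp (Ext.mk₀ e.inv) (add_zero 1)) 0, Ext.zero_comp]

instance (P : ObjectProperty A) : (leftOrth.{w} P).IsClosedUnderIsomorphisms where
  of_iso {X Y} e hX B hB := by
    have := hX B hB
    refine subsingleton_of_forall_eq 0 fun x => ?_
    have h : (Ext.mk₀ e.inv).comp ((Ext.mk₀ e.hom).comp x (zero_add 1)) (zero_add 1) = x := by
      simp
    rw [← h, Subsingleton.elim ((Ext.mk₀ e.hom).comp x (zero_add 1)) 0, Ext.comp_zero]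

instance (P : ObjectProperty A) : (rightOrth.{w} P).ContainsZero where
  exists_zero := ⟨0, isZero_zero A, fun B _ => by
    refine subsingleton_of_forall_eq 0 fun x => ?_
    rw [← Ext.comp_mk₀_id x, (isZero_zero A).eq_of_src (𝟙 (0 : A)) 0, Ext.mk₀_zero, Ext.comp_zero]⟩

instance (P : ObjectProperty A) : (leftOrth.{w} P).ContainsZero where
  exists_zero := ⟨0, isZero_zero A, fun B _ => by
    refine subsingleton_of_forall_eq 0 fun x => ?_
    rw [← Ext.mk₀_id_comp x, (isZero_zero A).eq_of_src (𝟙 (0 : A)) 0, Ext.mk₀_zero, Ext.zero_comp]⟩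

end Subalgebra

section Brick

variable {A : Type u} [Category.{v} A] [Abelian A]

/-- A brick: a non-zero object all of whose non-zero endomorphisms are invertible. -/
def IsBrick (E : A) : Prop :=
  ¬ IsZero E ∧ ∀ f : E ⟶ E, f ≠ 0 → IsIso f

/-- The number `q_E` of endomorphisms of `E`. -/
noncomputable def qE (E : A) : ℚ := Nat.card (E ⟶ E)

end Brick

section Ore

/-- `S` is an Ore set: it contains no zero divisors, and for all `a` and all `s ∈ S` there are
`u, u'` and `t, t' ∈ S` with `a * t = s * u` and `t' * a = u' * s`. -/
def IsOre {R : Type*} [Ring R] (S : Submonoid R) : Prop :=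
  (∀ s ∈ S, s ∈ nonZeroDivisors R) ∧
    ∀ a : R, ∀ s ∈ S, (∃ u : R, ∃ t ∈ S, a * t = s * u) ∧ ∃ u' : R, ∃ t' ∈ S, t' * a = u' * s

/-- The data from which Mathlib builds the ring of fractions. -/
@[reducible] noncomputable def IsOre.oreSet {R : Type*} [Ring R] {S : Submonoid R} (h : IsOre S) :
    OreLocalization.OreSet S :=
  Classical.choice (OreLocalization.nonempty_oreSet_iff.2
    ⟨fun r₁ r₂ s hs => ⟨1, by
        have := (mem_nonZeroDivisors_iff.1 (h.1 s s.2)).2 (r₁ - r₂) (by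
          rw [sub_mul, sub_eq_zero]; exact hs)
        rw [sub_eq_zero.1 this]⟩,
      fun r s => by
        obtain ⟨u, t, ht, e⟩ := (h.2 r s s.2).2
        exact ⟨u, ⟨t, ht⟩, e⟩⟩)

variable {A : Type u} [Category.{v} A] [Abelian A] [HomFinite A]

/-- The multiplicatively closed set generated by `1 + (q_E - 1) q_E ^ j [E]` for `j ∈ ℤ`. -/
noncomputable def oreSubmonoid (E : A) : Submonoid (CompletedHall A) :=
  Submonoid.closure
    (Set.range fun j : ℤ => 1 + ((qE E - 1) * qE E ^ j) • basisElt E)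

/-- `S` lies in `H` and is an Ore set in `H`, and conjugation by `u` defines an automorphism of
the localization `H[S⁻¹]`. Here `H[S⁻¹]` is embedded in the ambient algebra `B` by the unique
homomorphism `ι` that is the inclusion on `H`. -/
def ConjugationDefinesAut {B : Type*} [Ring B] [Algebra ℚ B] (H : Subalgebra ℚ B)
    (S : Submonoid B) (u : Bˣ) : Prop :=
  S ≤ H.toSubmonoid ∧
    ∃ hS : IsOre (S.comap H.val.toMonoidHom),
      letI := hS.oreSet
      ∃ (ι : OreLocalization (S.comap H.val.toMonoidHom) H →ₐ[ℚ] B)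
        (φ : OreLocalization (S.comap H.val.toMonoidHom) H ≃ₐ[ℚ]
          OreLocalization (S.comap H.val.toMonoidHom) H),
        Function.Injective ι ∧
        (∀ x : H, ι (OreLocalization.numeratorHom x) = (x : B)) ∧
        ∀ z, ι (φ z) = (u : B) * ι z * ((u⁻¹ : Bˣ) : B)

end Ore

end HallAlgebra

/-!
Write `q = q_E` and `e = [E]`. Two facts carry the proof.

The first is a commutation rule. Suppose `Ext¹(C, E) = 0` and `|Hom(C, E)| = q ^ m |Hom(E, C)|`;
such an `m` exists because both sets are vector spaces over `End E`. In `e [C] - q ^ m [C] e` the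
split extension cancels: a decomposition of an object into two summands can be read off from either
of the two complementary idempotents, which compares the Hall numbers of the two orders
(`coeff_mul_comm_of_split`). What remains are non-split extensions `K` of `E` by `C`. The long exact
sequences show that `m` is replaced by `m + 1` for `K`, and that `Ext¹(E, K)` is smaller than
`Ext¹(E, C)` (`IsBrick.nonsplit_extension_left`). So the `q`-commutators
`x₀ = [C]`, `x₁ = e x₀ - q ^ m x₀ e`, `x₂ = e x₁ - q ^ (m + 1) x₁ e`, … vanish eventually. If
`Ext¹(E, C) = 0` instead, the same happens with `m - 1` and with `Ext¹(-, E)`. If `E` is injective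
or projective, one of the two cases applies to all objects. The Ore condition for the elements
`1 + (q - 1) q ^ j e` follows by induction on the size of `Ext¹` (`ore_of_weights`).

The second is that power series can be evaluated at `e` (`PowersSummable.eval`), since `e ^ n` is
`[n]_q!` times the class of `E ^ n` (`IsBrick.coeff_pow`). This provides units
`exp_q(q ^ m e)`, and `exp_q(q ^ (m + 1) e) = (1 + (q - 1) q ^ m e) exp_q(q ^ m e)` (`qExp_succ`),
so they differ from one another by quotients of elements of `S_E`. The `q`-binomial theorem, applied
to the commutation rule, gives `exp_q(e) x₀ = (∑ k, x_k / [k]_q!) exp_q(q ^ m e)`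
(`PowersSummable.eval_qExp_mul`), or the mirror image in the second case
(`PowersSummable.mul_eval_qExp`). Hence conjugation by `exp_q(e)`, or by its inverse, maps `H` to
`H[S_E⁻¹]`. The leading term of the result is `x₀` times a unit of `H[S_E⁻¹]`, so the opposite
conjugation also maps `H` to `H[S_E⁻¹]`, again by induction on the size of `Ext¹`
(`conjugationDefinesAut_of_weights`).
-/

namespace HallAlgebra

/-! ### Ore localization and conjugation in an ambient algebra -/

section Conjugation

variable {B : Type*} [Ring B] [Algebra ℚ B]

/-- Conjugation by a unit `u`, as an automorphism of a subalgebra that it preserves. -/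
def conjAlgEquiv (L : Subalgebra ℚ B) (u : Bˣ)
    (h : ∀ b ∈ L, (u : B) * b * ((u⁻¹ : Bˣ) : B) ∈ L ∧ ((u⁻¹ : Bˣ) : B) * b * u ∈ L) :
    L ≃ₐ[ℚ] L where
  toFun b := ⟨u * b * ((u⁻¹ : Bˣ) : B), (h b b.2).1⟩
  invFun b := ⟨((u⁻¹ : Bˣ) : B) * b * u, (h b b.2).2⟩
  left_inv b := Subtype.ext (by simp [mul_assoc])
  right_inv b := Subtype.ext (by simp [mul_assoc])
  map_mul' b b' := Subtype.ext (by simp [mul_assoc])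
  map_add' b b' := Subtype.ext (by simp [mul_add, add_mul])
  commutes' r := Subtype.ext (by simp [← Algebra.commutes r (u : B), mul_assoc])

/-- If the elements of `S` are units of the ambient algebra `B`, the localization `H[S⁻¹]` is
identified with its image `L` in `B`, and conjugation by `u` has to be controlled only on `H`. -/
theorem conjugationDefinesAut_of_conj_mem (H : Subalgebra ℚ B) (S : Submonoid B) (u : Bˣ)
    (hSH : ∀ s ∈ S, s ∈ H) (hunit : ∀ s ∈ S, IsUnit s)
    (hore : ∀ a ∈ H, ∀ s ∈ S, (∃ y ∈ H, ∃ t ∈ S, a * t = s * y) ∧ ∃ y ∈ H, ∃ t ∈ S, t * a = y * s)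
    (hu : ∀ s ∈ S, Commute (u : B) s)
    (hconj : ∀ L : Subalgebra ℚ B, H ≤ L → (∀ s : Bˣ, (s : B) ∈ S → ((s⁻¹ : Bˣ) : B) ∈ L) →
      ∀ x ∈ H, (u : B) * x * ((u⁻¹ : Bˣ) : B) ∈ L ∧ ((u⁻¹ : Bˣ) : B) * x * u ∈ L) :
    ConjugationDefinesAut H S u := by
  have hS : IsOre (S.comap H.val.toMonoidHom) := by
    refine ⟨fun s hs => ?_, fun a s hs => ⟨?_, ?_⟩⟩
    · have h := hunit _ hs
      rw [mem_nonZeroDivisors_iff]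
      refine ⟨fun x hx => Subtype.ext (h.mul_right_eq_zero.1 ?_),
        fun x hx => Subtype.ext (h.mul_left_eq_zero.1 ?_)⟩
      · exact congrArg Subtype.val hx
      · exact congrArg Subtype.val hx
    · obtain ⟨y, hy, t, ht, e⟩ := (hore a a.2 s hs).1
      exact ⟨⟨y, hy⟩, ⟨t, hSH t ht⟩, ht, Subtype.ext e⟩
    · obtain ⟨y, hy, t, ht, e⟩ := (hore a a.2 s hs).2
      exact ⟨⟨y, hy⟩, ⟨t, hSH t ht⟩, ht, Subtype.ext e⟩
  refine ⟨fun s hs => hSH s hs, hS, ?_⟩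
  let := hS.oreSet
  let f : H →+* B := H.val.toRingHom
  let fS : (S.comap H.val.toMonoidHom) →* Bˣ :=
    IsUnit.liftRight ((f : H →* B).comp (S.comap H.val.toMonoidHom).subtype)
      (fun s => hunit _ s.2)
  have hf : ∀ s : S.comap H.val.toMonoidHom, f s = fS s := fun s =>
    (IsUnit.coe_liftRight ((f : H →* B).comp (S.comap H.val.toMonoidHom).subtype)
      (fun s => hunit _ s.2) s).symm
  let ι : OreLocalization (S.comap H.val.toMonoidHom) H →ₐ[ℚ] B :=
    (OreLocalization.universalHom f fS hf).toRatAlgHom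
  have hι : ∀ (r : H) (s : S.comap H.val.toMonoidHom),
      ι (OreLocalization.oreDiv r s) = ((fS s)⁻¹ : Bˣ) * (r : B) := fun r s =>
    OreLocalization.universalHom_apply f fS hf
  have hnum : ∀ x : H, ι (OreLocalization.numeratorHom x) = (x : B) := fun x =>
    OreLocalization.universalHom_commutes f fS hf
  have hinj : Function.Injective ι := by
    rw [injective_iff_map_eq_zero]
    intro z
    induction z using OreLocalization.ind with
    | _ r s =>
      intro h
      rw [hι, Units.mul_right_eq_zero] at h
      rw [Subtype.ext h (a2 := (0 : H)), OreLocalization.zero_oreDiv]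
  have hHL : H ≤ ι.range := fun x hx => ⟨OreLocalization.numeratorHom ⟨x, hx⟩, hnum _⟩
  have hSL : ∀ s : Bˣ, (s : B) ∈ S → ((s⁻¹ : Bˣ) : B) ∈ ι.range := by
    intro s hs
    refine ⟨OreLocalization.oreDiv 1 ⟨⟨s, hSH s hs⟩, hs⟩, ?_⟩
    have : fS ⟨⟨s, hSH s hs⟩, hs⟩ = s := Units.ext (hf _).symm
    exact (hι _ _).trans (by rw [this]; simp)
  have hmem : ∀ b ∈ ι.range,
      (u : B) * b * ((u⁻¹ : Bˣ) : B) ∈ ι.range ∧ ((u⁻¹ : Bˣ) : B) * b * u ∈ ι.range := by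
    rintro _ ⟨z, rfl⟩
    induction z using OreLocalization.ind with
    | _ r s =>
      obtain ⟨h1, h2⟩ := hconj ι.range hHL hSL r r.2
      have hs : ((fS s : Bˣ) : B) ∈ S := by rw [← hf]; exact s.2
      have hc : Commute u (fS s) := Units.ext (hu _ hs)
      have hc1 : Commute (u : B) (((fS s)⁻¹ : Bˣ) : B) := congrArg Units.val hc.inv_right
      have hc2 : Commute (((u⁻¹ : Bˣ)) : B) (((fS s)⁻¹ : Bˣ) : B) :=
        congrArg Units.val hc.inv_left.inv_right
      have hs' := hSL _ hs
      change (u : B) * ι _ * _ ∈ _ ∧ _ * ι _ * (u : B) ∈ _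
      rw [hι]
      constructor
      · rw [← mul_assoc, hc1.eq, mul_assoc _ (u : B), mul_assoc]
        exact mul_mem hs' h1
      · rw [← mul_assoc, hc2.eq, mul_assoc _ ((u⁻¹ : Bˣ) : B), mul_assoc]
        exact mul_mem hs' h2
  let c := conjAlgEquiv ι.range u hmem
  let j := AlgEquiv.ofInjective ι hinj
  refine ⟨ι, (j.trans c).trans j.symm, hinj, hnum, fun z => ?_⟩
  have : j ((j.trans c).trans j.symm z) = c (j z) :=
    j.apply_symm_apply (c (j z))
  exact congrArg Subtype.val this

/-- The Ore condition for a subalgebra `H` spanned by spaces `W m d`, with a weight `m ∈ ℤ` and a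
filtration index `d ∈ ℕ`, such that on `W m d` the left and the right multiplication by `e` agree up
to the factor `q ^ m` and terms of smaller `d`. The proof is by induction on `d`. -/
theorem ore_of_weights (H : Subalgebra ℚ B) (e : B) (q : ℚ) (hq : q ≠ 0) (ε : ℤ) (he : e ∈ H)
    (W : ℤ → ℕ → Submodule ℚ B) (hWH : ∀ m d, W m d ≤ H.toSubmodule) (hW0 : ∀ m, W m 0 = ⊥)
    (hcomm : ∀ m d, ∀ x ∈ W m (d + 1), e * x - q ^ m • (x * e) ∈ W (m + ε) d)
    (hgen : H.toSubmodule ≤ ⨆ i : ℤ × ℕ, W i.1 i.2)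
    (S : Submonoid B)
    (hS : S = Submonoid.closure (Set.range fun j : ℤ => 1 + ((q - 1) * q ^ j) • e)) :
    ∀ a ∈ H, ∀ s ∈ S, (∃ y ∈ H, ∃ t ∈ S, a * t = s * y) ∧ ∃ y ∈ H, ∃ t ∈ S, t * a = y * s := by
  set σ : ℤ → B := fun j => 1 + ((q - 1) * q ^ j) • e with hσ
  have hσS : ∀ j, σ j ∈ S := fun j => hS ▸ Submonoid.subset_closure ⟨j, rfl⟩
  have hσH : ∀ j, σ j ∈ H := fun j => add_mem (one_mem H) (H.smul_mem he _)
  have hSH : S ≤ H.toSubmonoid := by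
    rw [hS, Submonoid.closure_le]
    rintro _ ⟨j, rfl⟩
    exact hσH j
  have hσσ : ∀ i j, Commute (σ i) (σ j) := fun i j =>
    ((Commute.one_left _).add_left ((Commute.one_right _).add_right
      (((Commute.refl e).smul_left _).smul_right _)))
  have hSS : ∀ s ∈ S, ∀ t ∈ S, Commute s t := by
    intro s hs t ht
    rw [hS] at hs ht
    induction hs using Submonoid.closure_induction with
    | mem s hs =>
      obtain ⟨i, rfl⟩ := hs
      induction ht using Submonoid.closure_induction with
      | mem t ht => obtain ⟨j, rfl⟩ := ht; exact hσσ i j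
      | one => exact Commute.one_right _
      | mul _ _ _ _ h1 h2 => exact h1.mul_right h2
    | one => exact Commute.one_left _
    | mul _ _ _ _ h1 h2 => exact h1.mul_left h2
  -- Up to terms of smaller `d`, moving `x` past `σ j` shifts the index `j` by the weight of `x`.
  have hrel : ∀ m d, ∀ x ∈ W m d, ∀ j, σ j * x =
      x * σ (j + m) + ((q - 1) * q ^ j) • (e * x - q ^ m • (x * e)) := by
    intro m d x _ j
    simp only [hσ, add_mul, mul_add, one_mul, mul_one, smul_sub, smul_mul_assoc, mul_smul_comm,
      smul_smul, zpow_add₀ hq, mul_assoc]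
    abel
  have right : ∀ d m, ∀ x ∈ W m d, ∀ j, ∃ y ∈ H, ∃ t ∈ S, x * t = σ j * y := by
    intro d
    induction d with
    | zero =>
      intro m x hx j
      rw [hW0, Submodule.mem_bot] at hx
      exact ⟨0, zero_mem _, 1, one_mem _, by simp [hx]⟩
    | succ d ih =>
      intro m x hx j
      obtain ⟨y, hy, t, ht, h⟩ := ih _ _ (hcomm m d x hx) j
      refine ⟨x * t - ((q - 1) * q ^ j) • y,
        sub_mem (mul_mem (hWH _ _ hx) (hSH ht)) (H.smul_mem hy _), σ (j + m) * t,
        mul_mem (hσS _) ht, ?_⟩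
      rw [mul_sub, ← mul_assoc, ← mul_assoc, hrel m _ x hx j, add_mul, smul_mul_assoc, h,
        mul_smul_comm, add_sub_cancel_right]
  have left : ∀ d m, ∀ x ∈ W m d, ∀ j, ∃ y ∈ H, ∃ t ∈ S, t * x = y * σ j := by
    intro d
    induction d with
    | zero =>
      intro m x hx j
      rw [hW0, Submodule.mem_bot] at hx
      exact ⟨0, zero_mem _, 1, one_mem _, by simp [hx]⟩
    | succ d ih =>
      intro m x hx j
      obtain ⟨y, hy, t, ht, h⟩ := ih _ _ (hcomm m d x hx) j
      refine ⟨t * x + ((q - 1) * q ^ (j - m)) • y,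
        add_mem (mul_mem (hSH ht) (hWH _ _ hx)) (H.smul_mem hy _), t * σ (j - m),
        mul_mem ht (hσS _), ?_⟩
      rw [mul_assoc, hrel m _ x hx (j - m), sub_add_cancel, mul_add, add_mul, smul_mul_assoc, ← h,
        mul_smul_comm, mul_assoc]
  have genRight : ∀ a ∈ H, ∀ j, ∃ y ∈ H, ∃ t ∈ S, a * t = σ j * y := by
    intro a ha j
    refine Submodule.iSup_induction _ (motive := fun a => ∃ y ∈ H, ∃ t ∈ S, a * t = σ j * y)
      (hgen ha) (fun i x hx => right _ _ x hx j) ⟨0, zero_mem _, 1, one_mem _, by simp⟩ ?_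
    rintro a b ⟨y, hy, t, ht, h⟩ ⟨y', hy', t', ht', h'⟩
    refine ⟨y * t' + y' * t, add_mem (mul_mem hy (hSH ht')) (mul_mem hy' (hSH ht)), t * t',
      mul_mem ht ht', ?_⟩
    rw [add_mul, mul_add, ← mul_assoc, h, (hSS t ht t' ht').eq, ← mul_assoc, h', mul_assoc,
      mul_assoc]
  have genLeft : ∀ a ∈ H, ∀ j, ∃ y ∈ H, ∃ t ∈ S, t * a = y * σ j := by
    intro a ha j
    refine Submodule.iSup_induction _ (motive := fun a => ∃ y ∈ H, ∃ t ∈ S, t * a = y * σ j)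
      (hgen ha) (fun i x hx => left _ _ x hx j) ⟨0, zero_mem _, 1, one_mem _, by simp⟩ ?_
    rintro a b ⟨y, hy, t, ht, h⟩ ⟨y', hy', t', ht', h'⟩
    refine ⟨t' * y + t * y', add_mem (mul_mem (hSH ht') hy) (mul_mem (hSH ht) hy'), t * t',
      mul_mem ht ht', ?_⟩
    rw [mul_add, add_mul, mul_assoc t t' b, h', (hSS t ht t' ht').eq, mul_assoc t', h, mul_assoc,
      mul_assoc]
  intro a ha s hs
  constructor
  · rw [hS] at hs
    revert a
    induction hs using Submonoid.closure_induction with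
    | mem s hs => obtain ⟨j, rfl⟩ := hs; exact fun a ha => genRight a ha j
    | one => exact fun a ha => ⟨a, ha, 1, one_mem _, by simp⟩
    | mul s s' _ _ h1 h2 =>
      intro a ha
      obtain ⟨y, hy, t, ht, h⟩ := h1 a ha
      obtain ⟨y', hy', t', ht', h'⟩ := h2 y hy
      exact ⟨y', hy', t * t', mul_mem ht ht', by rw [← mul_assoc, h, mul_assoc, h', mul_assoc]⟩
  · rw [hS] at hs
    revert a
    induction hs using Submonoid.closure_induction with
    | mem s hs => obtain ⟨j, rfl⟩ := hs; exact fun a ha => genLeft a ha j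
    | one => exact fun a ha => ⟨a, ha, 1, one_mem _, by simp⟩
    | mul s s' _ _ h1 h2 =>
      intro a ha
      obtain ⟨y', hy', t', ht', h'⟩ := h2 a ha
      obtain ⟨y, hy, t, ht, h⟩ := h1 y' hy'
      exact ⟨y, hy, t * t', mul_mem ht ht', by rw [mul_assoc, h', ← mul_assoc, h, mul_assoc]⟩

/-- The setting of `ore_of_weights`, with units `υ m` that play the role of the `q`-exponentials
of `q ^ m • e`. Conjugation by `υ 0`, or by its inverse, multiplies an element of weight `m`,
up to terms of smaller `d`, by a quotient of elements of `S`. -/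
theorem conjugationDefinesAut_of_weights (H : Subalgebra ℚ B) (e : B) (q : ℚ) (hq : q ≠ 0) (ε : ℤ)
    (he : e ∈ H) (W : ℤ → ℕ → Submodule ℚ B) (hWH : ∀ m d, W m d ≤ H.toSubmodule)
    (hW0 : ∀ m, W m 0 = ⊥)
    (hcomm : ∀ m d, ∀ x ∈ W m (d + 1), e * x - q ^ m • (x * e) ∈ W (m + ε) d)
    (hgen : H.toSubmodule ≤ ⨆ i : ℤ × ℕ, W i.1 i.2)
    (S : Submonoid B)
    (hS : S = Submonoid.closure (Set.range fun j : ℤ => 1 + ((q - 1) * q ^ j) • e))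
    (υ : ℤ → Bˣ) (hυ : ∀ m, ((υ (m + 1) : Bˣ) : B) = (1 + ((q - 1) * q ^ m) • e) * υ m)
    (hυe : ∀ m, Commute ((υ m : Bˣ) : B) e)
    (hconj : (∀ m d, ∀ x ∈ W m (d + 1), ∃ y ∈ ⨆ m, W m d,
        (υ 0 : B) * x = (x + y) * υ m) ∨
      (∀ m d, ∀ x ∈ W m (d + 1), ∃ y ∈ ⨆ m, W m d, x * (υ 0 : B) = υ (-m) * (x + y))) :
    ConjugationDefinesAut H S (υ 0) := by
  have hσu : ∀ j : ℤ, ∃ s : Bˣ, (s : B) = 1 + ((q - 1) * q ^ j) • e := fun j =>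
    ⟨υ (j + 1) * (υ j)⁻¹, by rw [Units.val_mul, hυ, mul_assoc, Units.mul_inv, mul_one]⟩
  have hSe : ∀ s ∈ S, Commute s e ∧ s ∈ H ∧ IsUnit s := by
    intro s hs
    rw [hS] at hs
    induction hs using Submonoid.closure_induction with
    | mem s hs =>
      obtain ⟨j, rfl⟩ := hs
      refine ⟨(Commute.one_left _).add_left ((Commute.refl e).smul_left _),
        add_mem (one_mem H) (H.smul_mem he _), ?_⟩
      obtain ⟨s, hs⟩ := hσu j
      exact ⟨s, hs⟩
    | one => exact ⟨Commute.one_left _, one_mem _, isUnit_one⟩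
    | mul _ _ _ _ h1 h2 => exact ⟨h1.1.mul_left h2.1, mul_mem h1.2.1 h2.2.1, h1.2.2.mul h2.2.2⟩
  have hυS : ∀ m, ∀ s ∈ S, Commute ((υ m : Bˣ) : B) s := by
    intro m s hs
    rw [hS] at hs
    induction hs using Submonoid.closure_induction with
    | mem s hs =>
      obtain ⟨j, rfl⟩ := hs
      exact (Commute.one_right _).add_right ((hυe m).smul_right _)
    | one => exact Commute.one_right _
    | mul _ _ _ _ h1 h2 => exact h1.mul_right h2
  refine conjugationDefinesAut_of_conj_mem H S (υ 0) (fun s hs => (hSe s hs).2.1)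
    (fun s hs => (hSe s hs).2.2)
    (ore_of_weights H e q hq ε he W hWH hW0 hcomm hgen S hS) (hυS 0) ?_
  intro L hHL hSL
  -- `υ m` and `υ 0` differ by a unit whose powers lie in `L`, and which commutes with `υ 0`.
  have hquot : ∀ m : ℤ, ∃ b : Bˣ, υ m = b * υ 0 ∧ (b : B) ∈ L ∧ ((b⁻¹ : Bˣ) : B) ∈ L ∧
      Commute b (υ 0) := by
    have hstep : ∀ m, ∃ s : Bˣ, υ (m + 1) = s * υ m ∧ (s : B) ∈ L ∧ ((s⁻¹ : Bˣ) : B) ∈ L ∧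
        Commute s (υ 0) := by
      intro m
      obtain ⟨s, hs⟩ := hσu m
      have hsS : (s : B) ∈ S := by rw [hs, hS]; exact Submonoid.subset_closure ⟨m, rfl⟩
      exact ⟨s, Units.ext (by rw [hυ, Units.val_mul, hs]), hHL (hSe _ hsS).2.1, hSL s hsS,
        Units.ext (hυS 0 _ hsS).symm⟩
    intro m
    induction m using Int.induction_on with
    | zero => exact ⟨1, by simp, by simp, by simp, Commute.one_left _⟩
    | succ i ih =>
      obtain ⟨b, h1, h2, h3, h4⟩ := ih
      obtain ⟨s, k1, k2, k3, k4⟩ := hstep i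
      exact ⟨s * b, by rw [k1, h1, mul_assoc], mul_mem k2 h2, by
        rw [mul_inv_rev]; exact mul_mem h3 k3, k4.mul_left h4⟩
    | pred i ih =>
      obtain ⟨b, h1, h2, h3, h4⟩ := ih
      obtain ⟨s, k1, k2, k3, k4⟩ := hstep (-i - 1)
      rw [sub_add_cancel] at k1
      refine ⟨s⁻¹ * b, by rw [mul_assoc, ← h1, k1, inv_mul_cancel_left], mul_mem k3 h2, ?_,
        k4.inv_left.mul_left h4⟩
      rw [mul_inv_rev, inv_inv]
      exact mul_mem h3 k2
  have hVL : ∀ d, ⨆ m, W m d ≤ L.toSubmodule := fun d =>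
    iSup_le fun m => (hWH m d).trans fun x hx => hHL hx
  -- Conjugation by one of `υ 0` and its inverse is described by `hconj`. Solving for `x` expresses
  -- the opposite conjugation on `W m (d + 1)` by the opposite conjugation on the spaces `W m d`.
  have key : ∀ u : Bˣ, (∀ m d, ∀ x ∈ W m (d + 1), ∃ y ∈ ⨆ m, W m d, ∃ a b : Bˣ,
      (a : B) ∈ L ∧ ((a⁻¹ : Bˣ) : B) ∈ L ∧ Commute a u ∧
      (b : B) ∈ L ∧ ((b⁻¹ : Bˣ) : B) ∈ L ∧ Commute b u ∧
      (u : B) * x * ((u⁻¹ : Bˣ) : B) = a * (x + y) * b) →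
      ∀ x ∈ H, (u : B) * x * ((u⁻¹ : Bˣ) : B) ∈ L ∧ ((u⁻¹ : Bˣ) : B) * x * u ∈ L := by
    intro u h
    have hadd : ∀ x y : B,
        ((u : B) * x * ((u⁻¹ : Bˣ) : B) ∈ L ∧ ((u⁻¹ : Bˣ) : B) * x * u ∈ L) →
        ((u : B) * y * ((u⁻¹ : Bˣ) : B) ∈ L ∧ ((u⁻¹ : Bˣ) : B) * y * u ∈ L) →
        ((u : B) * (x + y) * ((u⁻¹ : Bˣ) : B) ∈ L ∧ ((u⁻¹ : Bˣ) : B) * (x + y) * u ∈ L) := by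
      intro x y hx hy
      simp only [mul_add, add_mul]
      exact ⟨add_mem hx.1 hy.1, add_mem hx.2 hy.2⟩
    have hd : ∀ d m, ∀ x ∈ W m d,
        (u : B) * x * ((u⁻¹ : Bˣ) : B) ∈ L ∧ ((u⁻¹ : Bˣ) : B) * x * u ∈ L := by
      intro d
      induction d with
      | zero =>
        intro m x hx
        rw [hW0, Submodule.mem_bot] at hx
        simp [hx]
      | succ d ih =>
        intro m x hx
        obtain ⟨y, hy, a, b, ha, ha', hau, hb, hb', hbu, hxy⟩ := h m d x hx
        have hy2 := Submodule.iSup_induction _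
          (motive := fun y => (u : B) * y * ((u⁻¹ : Bˣ) : B) ∈ L ∧ ((u⁻¹ : Bˣ) : B) * y * u ∈ L)
          hy (fun m x hx => ih m x hx) (by simp) hadd
        refine ⟨?_, ?_⟩
        · rw [hxy]
          exact mul_mem (mul_mem ha (add_mem (hHL (hWH _ _ hx)) (hVL _ hy))) hb
        · have e1 : ((u⁻¹ : Bˣ) : B) * x * u =
              ((a⁻¹ : Bˣ) : B) * x * ((b⁻¹ : Bˣ) : B) - ((u⁻¹ : Bˣ) : B) * y * u := by
            have e2 : x = ((a⁻¹ : Bˣ) : B) * ((u : B) * x * ((u⁻¹ : Bˣ) : B)) *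
                ((b⁻¹ : Bˣ) : B) - y := by
              rw [hxy]; simp [mul_assoc]
            have c1 : ((u⁻¹ : Bˣ) : B) * ((a⁻¹ : Bˣ) : B) = ((a⁻¹ : Bˣ) : B) * ((u⁻¹ : Bˣ) : B) :=
              congrArg Units.val hau.inv_left.inv_right.symm.eq
            have c2 : ((b⁻¹ : Bˣ) : B) * (u : B) = (u : B) * ((b⁻¹ : Bˣ) : B) :=
              congrArg Units.val hbu.inv_left.eq
            conv_lhs => rw [e2]
            rw [mul_sub, sub_mul]
            congr 1
            calc _ = (((u⁻¹ : Bˣ) : B) * ((a⁻¹ : Bˣ) : B)) * ((u : B) * x * ((u⁻¹ : Bˣ) : B)) *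
                  (((b⁻¹ : Bˣ) : B) * (u : B)) := by simp only [mul_assoc]
              _ = _ := by rw [c1, c2]; simp [mul_assoc]
          rw [e1]
          exact sub_mem (mul_mem (mul_mem ha' (hHL (hWH _ _ hx))) hb') hy2.2
    intro x hx
    exact Submodule.iSup_induction _
      (motive := fun y => (u : B) * y * ((u⁻¹ : Bˣ) : B) ∈ L ∧ ((u⁻¹ : Bˣ) : B) * y * u ∈ L)
      (hgen hx) (fun i x hx => hd _ _ x hx) (by simp) hadd
  rcases hconj with hl | hr
  · refine key (υ 0) fun m d x hx => ?_
    obtain ⟨y, hy, h⟩ := hl m d x hx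
    obtain ⟨b, h1, h2, h3, h4⟩ := hquot m
    refine ⟨y, hy, 1, b, one_mem _, by simp, Commute.one_left _, h2, h3, h4, ?_⟩
    rw [h, h1, Units.val_one, one_mul, mul_assoc, Units.val_mul, mul_assoc, Units.mul_inv, mul_one]
  · intro x hx
    refine (key (υ 0)⁻¹ (fun m d x hx => ?_) x hx).symm.imp (by rw [inv_inv]; exact id) id
    obtain ⟨y, hy, h⟩ := hr m d x hx
    obtain ⟨b, h1, h2, h3, h4⟩ := hquot (-m)
    refine ⟨y, hy, b, 1, h2, h3, h4.inv_right, one_mem _, by simp, Commute.one_left _, ?_⟩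
    have c : ((υ 0)⁻¹ : Bˣ) * υ (-m) = b := by rw [h1, h4.eq, inv_mul_cancel_left]
    rw [inv_inv, mul_assoc, h, ← mul_assoc, ← Units.val_mul, c, Units.val_one, mul_one]

end Conjugation

/-! ### Cardinalities in short exact sequences, and Hall numbers of split extensions -/

section Cardinalities

variable {A : Type u} [Category.{v} A] [Abelian A]

theorem card_eq_mul_of_exact {X Y Z : Type*} [AddGroup X] [AddGroup Y] [AddGroup Z]
    (f : X →+ Y) (g : Y →+ Z) (hf : Function.Injective f) (hg : Function.Surjective g)
    (h : ∀ y, g y = 0 → ∃ x, f x = y) (h0 : ∀ x, g (f x) = 0) :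
    Nat.card Y = Nat.card X * Nat.card Z := by
  have h1 : g.ker = f.range := by
    ext y
    exact ⟨fun hy => h y hy, by rintro ⟨x, rfl⟩; exact h0 x⟩
  rw [AddSubgroup.card_eq_card_quotient_mul_card_addSubgroup g.ker,
    Nat.card_congr (QuotientAddGroup.quotientKerEquivOfSurjective g hg).toEquiv, h1,
    Nat.card_congr (AddMonoidHom.ofInjective hf).toEquiv.symm, mul_comm]

section ShortExact

variable {N K M : A} {f : N ⟶ K} {g : K ⟶ M} {zero : f ≫ g = 0}

theorem card_hom_from_eq (h : (ShortComplex.mk f g zero).ShortExact) (Y : A)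
    (hl : ∀ x : N ⟶ Y, ∃ y, f ≫ y = x) :
    Nat.card (K ⟶ Y) = Nat.card (M ⟶ Y) * Nat.card (N ⟶ Y) := by
  have : Epi g := h.epi_g
  refine card_eq_mul_of_exact (Preadditive.leftComp Y g) (Preadditive.leftComp Y f)
    (fun a b hab => (cancel_epi g).1 hab) hl (fun y hy => ⟨h.exact.desc y hy, h.exact.g_desc y hy⟩)
    (fun x => ?_)
  change f ≫ g ≫ x = 0
  rw [← Category.assoc, zero, zero_comp]

theorem card_hom_to_eq (h : (ShortComplex.mk f g zero).ShortExact) (X : A)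
    (hl : ∀ x : X ⟶ M, ∃ y, y ≫ g = x) :
    Nat.card (X ⟶ K) = Nat.card (X ⟶ N) * Nat.card (X ⟶ M) := by
  have : Mono f := h.mono_f
  refine card_eq_mul_of_exact (Preadditive.rightComp X f) (Preadditive.rightComp X g)
    (fun a b hab => (cancel_mono f).1 hab) hl (fun y hy => ⟨h.exact.lift y hy, h.exact.lift_f y hy⟩)
    (fun x => ?_)
  change (x ≫ f) ≫ g = 0
  rw [Category.assoc, zero, comp_zero]

variable [HasExt.{w} A]

theorem exists_extend_of_subsingleton_ext (h : (ShortComplex.mk f g zero).ShortExact) {Y : A}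
    [Subsingleton (Ext.{w} M Y 1)] (x : N ⟶ Y) : ∃ y, f ≫ y = x := by
  obtain ⟨y, hy⟩ := Ext.contravariant_sequence_exact₁ h Y (Ext.mk₀ x) (add_zero 1)
    (Subsingleton.elim _ _)
  obtain ⟨y, rfl⟩ := (Ext.mk₀_bijective _ _).2 y
  rw [Ext.mk₀_comp_mk₀] at hy
  exact ⟨y, (Ext.mk₀_bijective _ _).1 hy⟩

theorem exists_lift_of_subsingleton_ext (h : (ShortComplex.mk f g zero).ShortExact) {X : A}
    [Subsingleton (Ext.{w} X N 1)] (x : X ⟶ M) : ∃ y, y ≫ g = x := by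
  obtain ⟨y, hy⟩ := Ext.covariant_sequence_exact₃ X h (Ext.mk₀ x) (zero_add 1)
    (Subsingleton.elim _ _)
  obtain ⟨y, rfl⟩ := (Ext.mk₀_bijective _ _).2 y
  rw [Ext.mk₀_comp_mk₀] at hy
  exact ⟨y, (Ext.mk₀_bijective _ _).1 hy⟩

theorem exists_section_of_extClass_eq_zero (h : (ShortComplex.mk f g zero).ShortExact)
    (h0 : (h.extClass : Ext.{w} M N 1) = 0) : ∃ s, s ≫ g = 𝟙 M := by
  obtain ⟨y, hy⟩ := Ext.covariant_sequence_exact₃ M h (Ext.mk₀ (𝟙 M)) (zero_add 1)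
    (by rw [h0, Ext.comp_zero])
  obtain ⟨y, rfl⟩ := (Ext.mk₀_bijective _ _).2 y
  rw [Ext.mk₀_comp_mk₀] at hy
  exact ⟨y, (Ext.mk₀_bijective _ _).1 hy⟩

theorem extClass_eq_zero_of_retraction (h : (ShortComplex.mk f g zero).ShortExact)
    {r : K ⟶ N} (hr : f ≫ r = 𝟙 N) : (h.extClass : Ext.{w} M N 1) = 0 := by
  have h1 : (h.extClass : Ext.{w} M N 1).comp (Ext.mk₀ f) (add_zero 1) = 0 := h.extClass_comp
  have h2 := congrArg (fun x => Ext.comp x (Ext.mk₀ r) (add_zero 1)) h1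
  simpa [hr] using h2

end ShortExact

end Cardinalities

section Brick

variable {A : Type u} [Category.{v} A] [Abelian A] {E : A}

theorem IsBrick.nontrivial_end (hE : IsBrick E) : Nontrivial (E ⟶ E) :=
  ⟨⟨𝟙 E, 0, fun h => hE.1 ((IsZero.iff_id_eq_zero E).2 h)⟩⟩

theorem IsBrick.one_lt_card [HomFinite A] (hE : IsBrick E) : 1 < Nat.card (E ⟶ E) :=
  have := hE.nontrivial_end
  Finite.one_lt_card

theorem IsBrick.one_lt_qE [HomFinite A] (hE : IsBrick E) : 1 < qE E := by
  unfold qE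
  exact_mod_cast hE.one_lt_card

/-- `Hom(C, E)` and `Hom(E, C)` are vector spaces over the division ring `End E`. -/
theorem IsBrick.card_hom [HomFinite A] (hE : IsBrick E) (C : A) :
    (∃ n, Nat.card (C ⟶ E) = Nat.card (E ⟶ E) ^ n) ∧
      ∃ n, Nat.card (E ⟶ C) = Nat.card (E ⟶ E) ^ n := by
  have hnt : Nontrivial (End E) := hE.nontrivial_end
  have h1 : ∀ a : End E, IsUnit a ∨ a = 0 := fun a =>
    (eq_or_ne a 0).symm.imp_left fun ha => (isUnit_iff_isIso a).2 (hE.2 a ha)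
  have h2 : ∀ a : (End E)ᵐᵒᵖ, IsUnit a ∨ a = 0 := fun a =>
    (h1 a.unop).imp (fun h => by simpa using h.op) (fun h => by simpa using h)
  have hf : Finite (C ⟶ E) := inferInstance
  have hf' : Finite (E ⟶ C) := inferInstance
  constructor
  · let : DivisionRing (End E) := DivisionRing.ofIsUnitOrEqZero h1
    exact ⟨_, Module.natCard_eq_pow_finrank (K := End E) (V := (C ⟶ E))⟩
  · let : DivisionRing (End E)ᵐᵒᵖ := DivisionRing.ofIsUnitOrEqZero h2
    refine ⟨Module.finrank (End E)ᵐᵒᵖ (E ⟶ C), ?_⟩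
    rw [Module.natCard_eq_pow_finrank (K := (End E)ᵐᵒᵖ) (V := (E ⟶ C)),
      Nat.card_congr (MulOpposite.opEquiv (α := End E)).symm]
    rfl

variable [HasExt.{w} A] [ExtFinite.{w} A]

/-- A non-split extension `K` of the exceptional brick `E` by `C`: every morphism `C ⟶ E` extends to
`K`, every morphism `E ⟶ K` lands in `C`, and the class of the extension is in the kernel of the
surjection from `Ext¹(E, C)` to `Ext¹(E, K)`. -/
theorem IsBrick.nonsplit_extension_left (hE : IsBrick E) [Subsingleton (Ext.{w} E E 1)] {C K : A}
    {f : C ⟶ K} {g : K ⟶ E} {zero : f ≫ g = 0} (h : (ShortComplex.mk f g zero).ShortExact)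
    (hs : ¬ ∃ s, s ≫ g = 𝟙 E) :
    Nat.card (K ⟶ E) = Nat.card (E ⟶ E) * Nat.card (C ⟶ E) ∧
      Nat.card (E ⟶ K) = Nat.card (E ⟶ C) ∧
      Nat.card (Ext.{w} E K 1) < Nat.card (Ext.{w} E C 1) := by
  have hf : Mono f := h.mono_f
  refine ⟨card_hom_from_eq h E (exists_extend_of_subsingleton_ext.{w} h), ?_, ?_⟩
  · refine (Nat.card_congr (Equiv.ofBijective (fun x : E ⟶ C => x ≫ f)
      ⟨fun a b hab => (cancel_mono f).1 hab, fun y => ?_⟩)).symm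
    have h0 : y ≫ g = 0 := by
      by_contra hne
      have := hE.2 _ hne
      exact hs ⟨inv (y ≫ g) ≫ y, by rw [Category.assoc, IsIso.inv_hom_id]⟩
    exact ⟨h.exact.lift y h0, h.exact.lift_f y h0⟩
  · let F : Ext.{w} E C 1 → Ext.{w} E K 1 := fun x => x.comp (Ext.mk₀ f) (add_zero 1)
    have hsurj : Function.Surjective F := fun y =>
      Ext.covariant_sequence_exact₂ E h y (Subsingleton.elim _ _)
    refine lt_of_le_of_ne (Nat.card_le_card_of_surjective F hsurj) fun heq => hs ?_
    have hinj : Function.Injective F :=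
      ((Nat.bijective_iff_surjective_and_card F).2 ⟨hsurj, heq.symm⟩).1
    refine exists_section_of_extClass_eq_zero.{w} h (hinj ?_)
    exact h.extClass_comp.trans (Ext.zero_comp ..).symm

/-- A non-split extension `K` of `C` by the exceptional brick `E`: every morphism `E ⟶ C` lifts to
`K`, every morphism `K ⟶ E` vanishes on `E`, and the class of the extension is in the kernel of the
surjection from `Ext¹(C, E)` to `Ext¹(K, E)`. -/
theorem IsBrick.nonsplit_extension_right (hE : IsBrick E) [Subsingleton (Ext.{w} E E 1)] {C K : A}
    {f : E ⟶ K} {g : K ⟶ C} {zero : f ≫ g = 0} (h : (ShortComplex.mk f g zero).ShortExact)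
    (hs : ¬ ∃ s, s ≫ g = 𝟙 C) :
    Nat.card (E ⟶ K) = Nat.card (E ⟶ E) * Nat.card (E ⟶ C) ∧
      Nat.card (K ⟶ E) = Nat.card (C ⟶ E) ∧
      Nat.card (Ext.{w} K E 1) < Nat.card (Ext.{w} C E 1) := by
  have hg : Epi g := h.epi_g
  refine ⟨card_hom_to_eq h E (exists_lift_of_subsingleton_ext.{w} h), ?_, ?_⟩
  · refine (Nat.card_congr (Equiv.ofBijective (fun x : C ⟶ E => g ≫ x)
      ⟨fun a b hab => (cancel_epi g).1 hab, fun y => ?_⟩)).symm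
    have h0 : f ≫ y = 0 := by
      by_contra hne
      have := hE.2 _ hne
      refine hs (exists_section_of_extClass_eq_zero.{w} h
        (extClass_eq_zero_of_retraction h (r := y ≫ inv (f ≫ y)) ?_))
      rw [← Category.assoc, IsIso.hom_inv_id]
    exact ⟨h.exact.desc y h0, h.exact.g_desc y h0⟩
  · let F : Ext.{w} C E 1 → Ext.{w} K E 1 := fun x => (Ext.mk₀ g).comp x (zero_add 1)
    have hsurj : Function.Surjective F := fun y =>
      Ext.contravariant_sequence_exact₂ h E y (Subsingleton.elim _ _)
    refine lt_of_le_of_ne (Nat.card_le_card_of_surjective F hsurj) fun heq => hs ?_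
    have hinj : Function.Injective F :=
      ((Nat.bijective_iff_surjective_and_card F).2 ⟨hsurj, heq.symm⟩).1
    refine exists_section_of_extClass_eq_zero.{w} h (hinj ?_)
    exact h.comp_extClass.trans (Ext.comp_zero ..).symm

end Brick

section SplitCount

variable {A : Type u} [Category.{v} A] [Abelian A]

/-- Sections of `K ⟶ K / U` form a torsor under `Hom(K / U, U)`. -/
theorem card_sections {K M N : A} (U : Subobject K) (hN : Nonempty ((U : A) ≅ N))
    (hM : Nonempty (quot U ≅ M)) (h : ∃ s, s ≫ cokernel.π U.arrow = 𝟙 (quot U)) :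
    Nat.card {s : quot U ⟶ K // s ≫ cokernel.π U.arrow = 𝟙 (quot U)} = Nat.card (M ⟶ N) := by
  obtain ⟨i⟩ := hN
  obtain ⟨j⟩ := hM
  obtain ⟨s, hs⟩ := h
  refine (Nat.card_congr (Equiv.ofBijective
    (fun x : M ⟶ N => (⟨s + j.hom ≫ x ≫ i.inv ≫ U.arrow, by simp [hs]⟩ :
      {s : quot U ⟶ K // s ≫ cokernel.π U.arrow = 𝟙 (quot U)})) ⟨fun a b hab => ?_, ?_⟩)).symm
  · have := congrArg Subtype.val hab
    rw [add_right_inj, cancel_epi, ← Category.assoc, ← Category.assoc, cancel_mono,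
      cancel_mono] at this
    exact this
  · rintro ⟨t, ht⟩
    have h0 : (t - s) ≫ cokernel.π U.arrow = 0 := by rw [Preadditive.sub_comp, ht, hs, sub_self]
    refine ⟨j.inv ≫ Abelian.monoLift U.arrow _ h0 ≫ i.hom, Subtype.ext ?_⟩
    simp

/-- Idempotents of `K` with kernel `N` and image `M`. The image of `p` is expressed as the kernel of
`1 - p`, so that `p ↦ 1 - p` plainly exchanges the roles of `M` and `N`. -/
abbrev IdempotentsOfType (M N K : A) : Type v :=
  {p : K ⟶ K // p ≫ p = p ∧ Nonempty ((kernelSubobject p : A) ≅ N) ∧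
    Nonempty ((kernelSubobject (𝟙 K - p) : A) ≅ M)}

theorem nonempty_iso_ker_one_sub {K : A} (U : Subobject K) (s : quot U ⟶ K)
    (hs : s ≫ cokernel.π U.arrow = 𝟙 (quot U)) :
    Nonempty ((kernelSubobject (𝟙 K - cokernel.π U.arrow ≫ s) : A) ≅ quot U) := by
  have h0 : (kernelSubobject (𝟙 K - cokernel.π U.arrow ≫ s)).arrow =
      (kernelSubobject (𝟙 K - cokernel.π U.arrow ≫ s)).arrow ≫ cokernel.π U.arrow ≫ s := by
    have := kernelSubobject_arrow_comp (𝟙 K - cokernel.π U.arrow ≫ s)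
    rwa [Preadditive.comp_sub, Category.comp_id, sub_eq_zero] at this
  have h1 : s ≫ (𝟙 K - cokernel.π U.arrow ≫ s) = 0 := by
    rw [Preadditive.comp_sub, Category.comp_id, ← Category.assoc, hs, Category.id_comp, sub_self]
  refine ⟨⟨(kernelSubobject _).arrow ≫ cokernel.π U.arrow, factorThruKernelSubobject _ s h1,
    ?_, ?_⟩⟩
  · rw [← cancel_mono (kernelSubobject _).arrow, Category.assoc, Category.assoc,
      factorThruKernelSubobject_comp_arrow, Category.id_comp]
    exact h0.symm
  · rw [← Category.assoc, factorThruKernelSubobject_comp_arrow, hs]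

/-- An idempotent amounts to a subobject `U`, its kernel, with a section of `K ⟶ K / U`. -/
theorem card_idempotentsOfType [HomFinite A] (M N K : A)
    (h : ∀ U : Subobject K, Nonempty ((U : A) ≅ N) → Nonempty (quot U ≅ M) →
      ∃ s, s ≫ cokernel.π U.arrow = 𝟙 (quot U)) :
    Nat.card (IdempotentsOfType M N K) =
      Nat.card {U : Subobject K // Nonempty ((U : A) ≅ N) ∧ Nonempty (quot U ≅ M)} *
        Nat.card (M ⟶ N) := by
  let X := {U : Subobject K // Nonempty ((U : A) ≅ N) ∧ Nonempty (quot U ≅ M)}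
  have hX : Finite X := Set.finite_coe_iff.2
    ((finite_quot_iso K M).subset fun U hU => cls_eq_iff.2 hU.2)
  have hker : ∀ (U : Subobject K) (s : quot U ⟶ K), s ≫ cokernel.π U.arrow = 𝟙 (quot U) →
      kernelSubobject (cokernel.π U.arrow ≫ s) = U := by
    intro U s hs
    have : Mono (s ≫ cokernel.π U.arrow) := by rw [hs]; infer_instance
    have : Mono s := mono_of_mono s (cokernel.π U.arrow)
    rw [kernelSubobject_comp_mono, kernelSubobject_cokernel]
  let F : (Σ U : X, {s : quot U.1 ⟶ K // s ≫ cokernel.π U.1.arrow = 𝟙 (quot U.1)}) →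
      IdempotentsOfType M N K := fun x => ⟨cokernel.π x.1.1.arrow ≫ x.2.1, by
        rw [Category.assoc, reassoc_of% x.2.2], by rw [hker _ _ x.2.2]; exact x.1.2.1, by
        obtain ⟨i⟩ := nonempty_iso_ker_one_sub _ _ x.2.2
        obtain ⟨j⟩ := x.1.2.2
        exact ⟨i ≪≫ j⟩⟩
  have hF : Function.Bijective F := by
    constructor
    · rintro ⟨⟨U, hU⟩, s, hs⟩ ⟨⟨V, hV⟩, t, ht⟩ hst
      have hst' : cokernel.π U.arrow ≫ s = cokernel.π V.arrow ≫ t := congrArg Subtype.val hst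
      obtain rfl : U = V := by rw [← hker U s hs, ← hker V t ht, hst']
      obtain rfl : s = t := (cancel_epi _).1 hst'
      rfl
    · rintro ⟨p, hp, hN, hM⟩
      let d : quot (kernelSubobject p) ⟶ K :=
        cokernel.desc _ p (kernelSubobject_arrow_comp p)
      have hd : cokernel.π (kernelSubobject p).arrow ≫ d = p := cokernel.π_desc _ _ _
      have h0 : (𝟙 K - p) ≫ p = 0 := by
        rw [Preadditive.sub_comp, Category.id_comp, hp, sub_self]
      have h1 : (𝟙 K - p) ≫ cokernel.π (kernelSubobject p).arrow = 0 := by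
        rw [← factorThruKernelSubobject_comp_arrow p _ h0, Category.assoc, cokernel.condition,
          comp_zero]
      have hs : d ≫ cokernel.π (kernelSubobject p).arrow = 𝟙 _ := by
        rw [← cancel_epi (cokernel.π (kernelSubobject p).arrow), ← Category.assoc, hd,
          Category.comp_id]
        rw [Preadditive.sub_comp, Category.id_comp, sub_eq_zero] at h1
        exact h1.symm
      obtain ⟨i⟩ := nonempty_iso_ker_one_sub _ _ hs
      rw [hd] at i
      obtain ⟨j⟩ := hM
      exact ⟨⟨⟨kernelSubobject p, hN, ⟨i.symm ≪≫ j⟩⟩, d, hs⟩, Subtype.ext hd⟩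
  rw [← Nat.card_congr (Equiv.ofBijective F hF)]
  have := Fintype.ofFinite X
  rw [Nat.card_sigma, Finset.sum_congr rfl fun U _ =>
    card_sections U.1 U.2.1 U.2.2 (h U.1 U.2.1 U.2.2), Finset.sum_const, smul_eq_mul,
    Finset.card_univ, Nat.card_eq_fintype_card (α := X)]

/-- If all extensions of `M` by `N` and of `N` by `M` with middle term `K` split, then the Hall
numbers `F^K_{MN}` and `F^K_{NM}` differ by a ratio of sizes of `Hom` sets: an idempotent `p` of
`K` amounts to a decomposition of `K`, as does `1 - p`. -/
theorem coeff_mul_comm_of_split [HomFinite A] (M N K : A)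
    (h : ∀ U : Subobject K, Nonempty ((U : A) ≅ N) → Nonempty (quot U ≅ M) →
      ∃ s, s ≫ cokernel.π U.arrow = 𝟙 (quot U))
    (h' : ∀ U : Subobject K, Nonempty ((U : A) ≅ M) → Nonempty (quot U ≅ N) →
      ∃ s, s ≫ cokernel.π U.arrow = 𝟙 (quot U)) :
    (basisElt M * basisElt N).coeff (cls K) * Nat.card (M ⟶ N) =
      (basisElt N * basisElt M).coeff (cls K) * Nat.card (N ⟶ M) := by
  rw [coeff_basisElt_mul, coeff_basisElt_mul, ← Nat.cast_mul, ← Nat.cast_mul,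
    ← card_idempotentsOfType M N K h, ← card_idempotentsOfType N M K h']
  refine congrArg Nat.cast (Nat.card_congr ?_)
  have key : ∀ p : K ⟶ K, p ≫ p = p → (𝟙 K - p) ≫ (𝟙 K - p) = 𝟙 K - p := by
    intro p hp
    simp [Preadditive.sub_comp, Preadditive.comp_sub, hp]
  exact
    { toFun := fun p => ⟨𝟙 K - p.1, key _ p.2.1, p.2.2.2, by
        simpa only [sub_sub_cancel] using p.2.2.1⟩
      invFun := fun p => ⟨𝟙 K - p.1, key _ p.2.1, p.2.2.2, by
        simpa only [sub_sub_cancel] using p.2.2.1⟩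
      left_inv := fun p => Subtype.ext (sub_sub_cancel _ _)
      right_inv := fun p => Subtype.ext (sub_sub_cancel _ _) }

end SplitCount

/-! ### The category `add E` and the powers of `[E]` -/

section AddClosure

variable {A : Type u} [Category.{v} A] [Abelian A] {E : A}

attribute [local instance] Abelian.hasFiniteBiproducts in
theorem addClosure_iff_sum {M : A} : addClosure E M ↔
    ∃ (n : ℕ) (i : Fin n → (M ⟶ E)) (r : Fin n → (E ⟶ M)), ∑ j, i j ≫ r j = 𝟙 M := by
  constructor
  · rintro ⟨n, ⟨ρ⟩⟩
    refine ⟨n, fun j => ρ.i ≫ biproduct.π _ j,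
      fun j => biproduct.ι (fun _ : Fin n => E) j ≫ ρ.r, ?_⟩
    have h := congrArg (fun x => ρ.i ≫ x ≫ ρ.r) (biproduct.total (f := fun _ : Fin n => E))
    simp only [Preadditive.sum_comp, Preadditive.comp_sum, Category.id_comp, ρ.retract,
      Category.assoc] at h
    simpa only [Category.assoc] using h
  · rintro ⟨n, i, r, h⟩
    exact ⟨n, ⟨⟨biproduct.lift i, biproduct.desc r, by rw [biproduct.lift_desc, h]⟩⟩⟩

theorem addClosure_self : addClosure E E :=
  addClosure_iff_sum.2 ⟨1, fun _ => 𝟙 E, fun _ => 𝟙 E, by simp⟩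

theorem addClosure_of_retract {M N : A} (h : addClosure E M) (i : N ⟶ M) (r : M ⟶ N)
    (hir : i ≫ r = 𝟙 N) : addClosure E N := by
  obtain ⟨n, a, b, h⟩ := addClosure_iff_sum.1 h
  refine addClosure_iff_sum.2 ⟨n, fun j => i ≫ a j, fun j => b j ≫ r, ?_⟩
  have := congrArg (fun x => i ≫ x ≫ r) h
  simpa [Preadditive.sum_comp, Preadditive.comp_sum, hir] using this

theorem addClosure_of_iso {M N : A} (h : addClosure E M) (e : M ≅ N) : addClosure E N :=
  addClosure_of_retract h e.inv e.hom e.inv_hom_id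

theorem exists_addClosure_cls_iff {K : A} :
    (∃ M, cls M = cls K ∧ addClosure E M) ↔ addClosure E K := by
  refine ⟨?_, fun h => ⟨K, rfl, h⟩⟩
  rintro ⟨M, h, hM⟩
  obtain ⟨e⟩ := cls_eq_iff.1 h
  exact addClosure_of_iso hM e

section Ext

variable [HasExt.{w} A]

theorem subsingleton_ext_addClosure_right {C B : A} [Subsingleton (Ext.{w} C E 1)]
    (hB : addClosure E B) : Subsingleton (Ext.{w} C B 1) := by
  obtain ⟨n, i, r, h⟩ := addClosure_iff_sum.1 hB
  refine subsingleton_of_forall_eq 0 fun x => ?_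
  let φ : (B ⟶ B) →+ Ext.{w} C B 1 :=
    AddMonoidHom.mk' (fun t => x.comp (Ext.mk₀ t) (add_zero 1)) fun s t => by
      rw [Ext.mk₀_add, Ext.comp_add]
  have h1 : φ (𝟙 B) = x := Ext.comp_mk₀_id x
  rw [← h1, ← h, map_sum]
  refine Finset.sum_eq_zero fun j _ => ?_
  change x.comp (Ext.mk₀ (i j ≫ r j)) (add_zero 1) = 0
  rw [← Ext.mk₀_comp_mk₀, ← Ext.comp_assoc_of_third_deg_zero,
    Subsingleton.elim (x.comp (Ext.mk₀ (i j)) (add_zero 1)) 0, Ext.zero_comp]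

theorem subsingleton_ext_addClosure_left {C B : A} [Subsingleton (Ext.{w} E C 1)]
    (hB : addClosure E B) : Subsingleton (Ext.{w} B C 1) := by
  obtain ⟨n, i, r, h⟩ := addClosure_iff_sum.1 hB
  refine subsingleton_of_forall_eq 0 fun x => ?_
  let φ : (B ⟶ B) →+ Ext.{w} B C 1 :=
    AddMonoidHom.mk' (fun t => (Ext.mk₀ t).comp x (zero_add 1)) fun s t => by
      rw [Ext.mk₀_add, Ext.add_comp]
  have h1 : φ (𝟙 B) = x := Ext.mk₀_id_comp x
  rw [← h1, ← h, map_sum]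
  refine Finset.sum_eq_zero fun j _ => ?_
  change (Ext.mk₀ (i j ≫ r j)).comp x (zero_add 1) = 0
  rw [← Ext.mk₀_comp_mk₀_assoc,
    Subsingleton.elim ((Ext.mk₀ (r j)).comp x (zero_add 1)) 0, Ext.comp_zero]

theorem leftOrth_addClosure_iff {C : A} :
    leftOrth.{w} (addClosure E) C ↔ Subsingleton (Ext.{w} C E 1) :=
  ⟨fun h => h E addClosure_self, fun _ _ hB => subsingleton_ext_addClosure_right hB⟩

theorem rightOrth_addClosure_iff {C : A} :
    rightOrth.{w} (addClosure E) C ↔ Subsingleton (Ext.{w} E C 1) :=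
  ⟨fun h => h E addClosure_self, fun _ _ hB => subsingleton_ext_addClosure_left hB⟩

end Ext

/-- The identity of `K` factors through a power of `E`, so `E ⟶ K ⟶ E` is non-zero, hence
invertible, for some morphism `E ⟶ K`. -/
theorem IsBrick.exists_section (hE : IsBrick E) {K : A} (hK : addClosure E K) (g : K ⟶ E)
    (hg : g ≠ 0) : ∃ s, s ≫ g = 𝟙 E := by
  obtain ⟨n, i, r, h⟩ := addClosure_iff_sum.1 hK
  obtain ⟨j, hj⟩ : ∃ j, r j ≫ g ≠ 0 := by
    by_contra! hc
    apply hg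
    rw [← Category.id_comp g, ← h, Preadditive.sum_comp]
    exact Finset.sum_eq_zero fun j _ => by rw [Category.assoc, hc, comp_zero]
  have := hE.2 _ hj
  exact ⟨inv (r j ≫ g) ≫ r j, by rw [Category.assoc, IsIso.inv_hom_id]⟩

section ShortExact

variable {N K : A} {f : N ⟶ K} {g : K ⟶ E} {zero : f ≫ g = 0}

theorem addClosure_left_of_section (h : (ShortComplex.mk f g zero).ShortExact)
    (hK : addClosure E K) {s : E ⟶ K} (hs : s ≫ g = 𝟙 E) : addClosure E N := by
  have hf : Mono f := h.mono_f
  have h0 : (𝟙 K - g ≫ s) ≫ g = 0 := by simp [hs]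
  refine addClosure_of_retract hK f (h.exact.lift _ h0) ?_
  have h1 : h.exact.lift _ h0 ≫ f = 𝟙 K - g ≫ s := h.exact.lift_f _ _
  rw [← cancel_mono f, Category.assoc, h1, Preadditive.comp_sub, Category.comp_id,
    reassoc_of% zero, zero_comp, sub_zero, Category.id_comp]

theorem addClosure_middle_of_section (h : (ShortComplex.mk f g zero).ShortExact)
    (hN : addClosure E N) {s : E ⟶ K} (hs : s ≫ g = 𝟙 E) : addClosure E K := by
  obtain ⟨n, i, r, hir⟩ := addClosure_iff_sum.1 hN
  have hf : Mono f := h.mono_f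
  have h0 : (𝟙 K - g ≫ s) ≫ g = 0 := by simp [hs]
  have h1 : h.exact.lift _ h0 ≫ f = 𝟙 K - g ≫ s := h.exact.lift_f _ _
  refine addClosure_iff_sum.2 ⟨n + 1, Fin.cons g fun j => h.exact.lift _ h0 ≫ i j,
    Fin.cons s fun j => r j ≫ f, ?_⟩
  rw [Fin.sum_univ_succ]
  have := congrArg (fun x => h.exact.lift _ h0 ≫ x ≫ f) hir
  simp only [Preadditive.sum_comp, Preadditive.comp_sum, Category.id_comp, Category.assoc] at this
  simp only [Fin.cons_zero, Fin.cons_succ, Category.assoc]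
  rw [this, h1, add_sub_cancel]

end ShortExact

end AddClosure

section Powers

variable {A : Type u} [Category.{v} A] [Abelian A] [HomFinite A] {E : A}

theorem card_ne_zero_add_one {X : Type*} [Finite X] (a : X) :
    Nat.card {x : X // x ≠ a} + 1 = Nat.card X := by
  classical
  rw [← Nat.card_congr (Equiv.optionSubtypeNe a), Finite.card_option]

/-- The surjections from an object of `add E` to `E` are the non-zero morphisms. Each subobject `U`
with `K / U ≅ E` is the kernel of `q_E - 1` of them. -/
theorem IsBrick.card_quot_iso (hE : IsBrick E) {K : A} (hK : addClosure E K) :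
    (Nat.card {U : Subobject K // cls (quot U) = cls E} : ℚ) * (qE E - 1) =
      Nat.card (K ⟶ E) - 1 := by
  let X := {U : Subobject K // cls (quot U) = cls E}
  have hX : Finite X := Set.finite_coe_iff.2 (finite_quot_iso K E)
  have hne : ∀ (U : Subobject K) (i : quot U ≅ E), cokernel.π U.arrow ≫ i.hom ≠ 0 := by
    intro U i h
    rw [← cancel_mono i.inv, Category.assoc, i.hom_inv_id, Category.comp_id, zero_comp] at h
    have h1 : 𝟙 (quot U) = 0 := by rw [← cancel_epi (cokernel.π U.arrow), h, zero_comp, zero_comp]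
    exact hE.1 (((IsZero.iff_id_eq_zero _).2 h1).of_iso i.symm)
  let F : (Σ U : X, (quot U.1 ≅ E)) → {x : K ⟶ E // x ≠ 0} := fun x =>
    ⟨cokernel.π x.1.1.arrow ≫ x.2.hom, hne _ _⟩
  have hker : ∀ (U : Subobject K) (i : quot U ≅ E),
      kernelSubobject (cokernel.π U.arrow ≫ i.hom) = U := fun U i => by
    rw [kernelSubobject_comp_mono, kernelSubobject_cokernel]
  have hF : Function.Bijective F := by
    constructor
    · rintro ⟨⟨U, hU⟩, i⟩ ⟨⟨V, hV⟩, j⟩ hij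
      have hij' : cokernel.π U.arrow ≫ i.hom = cokernel.π V.arrow ≫ j.hom :=
        congrArg Subtype.val hij
      obtain rfl : U = V := by
        rw [← hker U i, ← hker V j]
        simp only [hij']
      obtain rfl : i = j := Iso.ext ((cancel_epi _).1 hij')
      rfl
    · rintro ⟨x, hx⟩
      obtain ⟨s, hs⟩ := hE.exists_section hK x hx
      have : Epi (s ≫ x) := by rw [hs]; infer_instance
      have : Epi x := epi_of_epi s x
      obtain ⟨t, ht⟩ := (kernelSubobject_le_iff (cokernel.π (kernelSubobject x).arrow) x).1
        (kernelSubobject_cokernel _).le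
      obtain ⟨t', ht'⟩ := (kernelSubobject_le_iff x (cokernel.π (kernelSubobject x).arrow)).1
        (kernelSubobject_cokernel _).ge
      refine ⟨⟨⟨kernelSubobject x, cls_quot_kernel x⟩, ⟨t, t', ?_, ?_⟩⟩, Subtype.ext ht⟩
      · rw [← cancel_epi (cokernel.π (kernelSubobject x).arrow), reassoc_of% ht, ht',
          Category.comp_id]
      · rw [← cancel_epi x, reassoc_of% ht', ht, Category.comp_id]
  have hiso : ∀ U : X, Nat.card (quot U.1 ≅ E) = Nat.card {x : E ⟶ E // x ≠ 0} := by
    rintro ⟨U, hU⟩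
    obtain ⟨i⟩ := cls_eq_iff.1 hU
    refine Nat.card_congr
      { toFun := fun j => ⟨(i.symm ≪≫ j).hom, fun h => hE.1 ?_⟩
        invFun := fun x => have := hE.2 x.1 x.2; i ≪≫ asIso x.1
        left_inv := fun j => by ext; simp
        right_inv := fun x => by ext; simp }
    rw [IsZero.iff_id_eq_zero, ← (i.symm ≪≫ j).hom_inv_id, h, zero_comp]
  have h1 := Nat.card_congr (Equiv.ofBijective F hF)
  have := Fintype.ofFinite X
  have : ∀ U : X, Finite (quot U.1 ≅ E) := fun U =>
    Finite.of_injective Iso.hom fun _ _ h => Iso.ext h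
  rw [Nat.card_sigma, Finset.sum_congr rfl fun U _ => hiso U, Finset.sum_const, smul_eq_mul,
    Finset.card_univ, ← Nat.card_eq_fintype_card (α := X)] at h1
  have h2 := card_ne_zero_add_one (0 : K ⟶ E)
  have h3 := card_ne_zero_add_one (0 : E ⟶ E)
  rw [qE, ← h2, ← h3]
  push_cast
  rw [add_sub_cancel_right, add_sub_cancel_right]
  exact_mod_cast h1

open Classical in
theorem coeff_basisElt (M : A) (κ : IsoClass A) :
    (basisElt M).coeff κ = if κ = cls M then 1 else 0 := rfl

open Classical in
/-- The power `[E]^n` is `[n]_q!` times the class of `E^n`. Here `E^n` is described as the object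
`K` of `add E` with `|Hom(K, E)| = q_E ^ n`. -/
theorem IsBrick.coeff_pow [HasExt.{w} A] (hE : IsBrick E) [Subsingleton (Ext.{w} E E 1)] (n : ℕ)
    (K : A) :
    (basisElt E ^ n).coeff (cls K) =
      if addClosure E K ∧ Nat.card (K ⟶ E) = Nat.card (E ⟶ E) ^ n then
        qFactorial (qE E) n else 0 := by
  induction n generalizing K with
  | zero =>
    rw [pow_zero, CompletedHall.coeff_one, pow_zero, qFactorial, Finset.prod_range_zero]
    refine if_congr ?_ rfl rfl
    constructor
    · intro h
      obtain ⟨e⟩ := cls_eq_iff.1 h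
      have hz : IsZero K := (isZero_zero A).of_iso e
      refine ⟨addClosure_iff_sum.2 ⟨0, Fin.elim0, Fin.elim0, hz.eq_of_src _ _⟩, ?_⟩
      have : Subsingleton (K ⟶ E) := ⟨fun _ _ => hz.eq_of_src _ _⟩
      exact Nat.card_of_subsingleton 0
    · rintro ⟨hK, h⟩
      have : Subsingleton (K ⟶ E) := (Nat.card_eq_one_iff_unique.1 h).1
      obtain ⟨n, i, r, hir⟩ := addClosure_iff_sum.1 hK
      have hz : IsZero K := by
        rw [IsZero.iff_id_eq_zero, ← hir]
        exact Finset.sum_eq_zero fun j _ => by rw [Subsingleton.elim (i j) 0, zero_comp]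
      exact cls_eq_of_iso (hz.iso (isZero_zero A))
  | succ n ih =>
    have hq : 0 < Nat.card (E ⟶ E) := zero_lt_one.trans hE.one_lt_card
    rw [pow_succ', CompletedHall.coeff_mul_cls]
    by_cases hK : addClosure E K ∧ Nat.card (K ⟶ E) = Nat.card (E ⟶ E) ^ (n + 1)
    · rw [if_pos hK]
      have hterm : ∀ U : Subobject K, (basisElt E).coeff (cls (quot U)) *
          (basisElt E ^ n).coeff (cls (U : A)) =
          ∑ᶠ _ : U ∈ {U : Subobject K | cls (quot U) = cls E}, qFactorial (qE E) n := by
        intro U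
        rw [finsum_eq_if, coeff_basisElt]
        simp only [Set.mem_ofPred_eq]
        split_ifs with hU
        · obtain ⟨f, g, zero, h⟩ := isExtension_of_cls U rfl hU
          have hepi : Epi g := h.epi_g
          have hg : g ≠ 0 := fun h0 => hE.1 (by
            rw [IsZero.iff_id_eq_zero, ← cancel_epi g, h0, zero_comp, zero_comp])
          obtain ⟨s, hs⟩ := hE.exists_section hK.1 g hg
          have hc := card_hom_from_eq h E (exists_extend_of_subsingleton_ext.{w} h)
          rw [ih, if_pos, one_mul]
          refine ⟨addClosure_left_of_section h hK.1 hs, ?_⟩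
          rw [hK.2, pow_succ'] at hc
          exact (Nat.eq_of_mul_eq_mul_left hq hc).symm
        · rw [zero_mul]
      have hfin := finite_quot_iso K E
      rw [finsum_congr hterm, finsum_mem_eq_finite_toFinset_sum _ hfin, Finset.sum_const,
        nsmul_eq_mul, ← Nat.card_eq_card_finite_toFinset hfin, qFactorial, qFactorial,
        Finset.prod_range_succ, mul_comm]
      congr 1
      have h1 := hE.card_quot_iso hK.1
      rw [hK.2, Nat.cast_pow] at h1
      have h2 := geom_sum_mul (qE E) (n + 1)
      exact mul_right_cancel₀ (sub_ne_zero.2 hE.one_lt_qE.ne') (h1.trans h2.symm)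
    · rw [if_neg hK]
      refine (finsum_congr fun U => ?_).trans finsum_zero
      rw [coeff_basisElt, ih]
      split_ifs with hU hU'
      · obtain ⟨f, g, zero, h⟩ := isExtension_of_cls U rfl hU
        have := subsingleton_ext_addClosure_right.{w} (C := E) hU'.1
        obtain ⟨s, hs⟩ := exists_lift_of_subsingleton_ext.{w} h (𝟙 E)
        refine (hK ⟨addClosure_middle_of_section h hU'.1 hs, ?_⟩).elim
        rw [card_hom_from_eq h E (exists_extend_of_subsingleton_ext.{w} h), hU'.2, pow_succ']
      · rw [mul_zero]
      · rw [zero_mul]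
      · rw [zero_mul]

theorem qFactorial_pos {q : ℚ} (hq : 0 < q) (n : ℕ) : 0 < qFactorial q n :=
  Finset.prod_pos fun k _ => Finset.sum_pos (fun i _ => pow_pos hq i) ⟨0, by simp⟩

theorem IsBrick.qE_pos (hE : IsBrick E) : 0 < qE E := zero_lt_one.trans hE.one_lt_qE

variable [HasExt.{w} A]

/-- Each class occurs in at most one power of `[E]`. -/
theorem IsBrick.exists_forall_coeff_pow_eq_zero (hE : IsBrick E)
    (hExt : Subsingleton (Ext.{w} E E 1)) (κ : IsoClass A) :
    ∃ n₀ : ℕ, ∀ n, n ≠ n₀ → (basisElt E ^ n).coeff κ = 0 := by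
  obtain ⟨K, rfl⟩ := exists_cls κ
  obtain ⟨n₀, h⟩ := (hE.card_hom K).1
  refine ⟨n₀, fun n hn => ?_⟩
  rw [hE.coeff_pow.{w}, if_neg]
  rintro ⟨_, h'⟩
  exact hn (Nat.pow_right_injective hE.one_lt_card (h'.symm.trans h))

theorem IsBrick.addClosure_of_coeff_pow_ne_zero (hE : IsBrick E)
    (hExt : Subsingleton (Ext.{w} E E 1)) {K : A} {n : ℕ}
    (h : (basisElt E ^ n).coeff (cls K) ≠ 0) : addClosure E K := by
  rw [hE.coeff_pow.{w}] at h
  by_contra hc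
  exact h (if_neg fun h' => hc h'.1)

theorem IsBrick.coeff_expAdd (hE : IsBrick E) (hExt : Subsingleton (Ext.{w} E E 1))
    (κ : IsoClass A) :
    (expAdd E).coeff κ = ∑ᶠ n : ℕ, (basisElt E ^ n).coeff κ / qFactorial (qE E) n := by
  classical
  obtain ⟨K, rfl⟩ := exists_cls κ
  obtain ⟨n, hn⟩ := (hE.card_hom K).1
  have h0 : (expAdd E).coeff (cls K) = if addClosure E K then 1 else 0 :=
    if_congr exists_addClosure_cls_iff rfl rfl
  rw [finsum_eq_single _ n, h0, hE.coeff_pow.{w}]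
  · by_cases hK : addClosure E K
    · rw [if_pos hK, if_pos ⟨hK, hn⟩, div_self (qFactorial_pos hE.qE_pos n).ne']
    · rw [if_neg hK, if_neg fun h => hK h.1, zero_div]
  · intro k hk
    rw [hE.coeff_pow.{w}, if_neg, zero_div]
    rintro ⟨_, h'⟩
    exact hk (Nat.pow_right_injective hE.one_lt_card (h'.symm.trans hn))

end Powers

/-! ### Evaluation of power series and `q`-exponentials -/

section SeriesEval

variable {A : Type u} [Category.{v} A] [Abelian A]

/-- The coefficient at a class, as a linear map. -/
noncomputable def coeffHom (κ : IsoClass A) : CompletedHall A →ₗ[ℚ] ℚ where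
  toFun x := x.coeff κ
  map_add' _ _ := rfl
  map_smul' _ _ := rfl

theorem coeff_sum {ι : Type*} (s : Finset ι) (x : ι → CompletedHall A) (κ : IsoClass A) :
    (∑ i ∈ s, x i).coeff κ = ∑ i ∈ s, (x i).coeff κ :=
  map_sum (coeffHom κ) x s

/-- Conditions under which power series can be evaluated at `e`: every class occurs in at most one
power of `e`, and the classes that occur in some power of `e` form a locally finite set. -/
structure PowersSummable (e : CompletedHall A) : Prop where
  coeff_pow : ∀ κ, ∃ n₀ : ℕ, ∀ n, n ≠ n₀ → (e ^ n).coeff κ = 0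
  finite : ∀ K : A, {U : Subobject K | ∃ n, (e ^ n).coeff (cls (quot U)) ≠ 0}.Finite

variable {e : CompletedHall A}

/-- The element `∑ n, f n • e ^ n` of the completed Hall algebra, for a power series `f`. -/
noncomputable def PowersSummable.evalFun (he : PowersSummable e) (f : PowerSeries ℚ) :
    CompletedHall A :=
  ⟨fun κ => ∑ᶠ n : ℕ, PowerSeries.coeff n f * (e ^ n).coeff κ, fun K =>
    (he.finite K).subset fun U hU => by
      by_contra hc
      simp only [Set.mem_ofPred_eq, not_exists, not_not] at hc
      exact hU ((finsum_congr fun n => by rw [hc, mul_zero]).trans finsum_zero)⟩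

theorem PowersSummable.coeff_evalFun (he : PowersSummable e) (f : PowerSeries ℚ) (κ : IsoClass A) :
    (he.evalFun f).coeff κ = ∑ᶠ n : ℕ, PowerSeries.coeff n f * (e ^ n).coeff κ := rfl

theorem PowersSummable.coeff_evalFun_eq (he : PowersSummable e) (f : PowerSeries ℚ)
    {κ : IsoClass A} {n₀ : ℕ} (h : ∀ n, n ≠ n₀ → (e ^ n).coeff κ = 0) :
    (he.evalFun f).coeff κ = PowerSeries.coeff n₀ f * (e ^ n₀).coeff κ :=
  finsum_eq_single _ n₀ fun n hn => by rw [h n hn, mul_zero]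

theorem coeff_aeval_eq (p : Polynomial ℚ) {κ : IsoClass A} {n₀ : ℕ}
    (h : ∀ n, n ≠ n₀ → (e ^ n).coeff κ = 0) :
    (Polynomial.aeval e p).coeff κ = p.coeff n₀ * (e ^ n₀).coeff κ := by
  induction p using Polynomial.induction_on' with
  | add p q hp hq =>
    rw [map_add, CompletedHall.coeff_add, Pi.add_apply, hp, hq, Polynomial.coeff_add, add_mul]
  | monomial n a =>
    rw [Polynomial.aeval_monomial, ← Algebra.smul_def, CompletedHall.coeff_smul, Pi.smul_apply,
      smul_eq_mul, Polynomial.coeff_monomial]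
    split_ifs with hn
    · rw [hn]
    · rw [h n hn, mul_zero, zero_mul]

theorem PowersSummable.exists_trunc (he : PowersSummable e) (κ : IsoClass A) :
    ∃ N₀ : ℕ, ∀ N, N₀ ≤ N → ∀ f : PowerSeries ℚ,
      (he.evalFun f).coeff κ = (Polynomial.aeval e (f.trunc N)).coeff κ := by
  obtain ⟨n₀, h⟩ := he.coeff_pow κ
  refine ⟨n₀ + 1, fun N hN f => ?_⟩
  rw [he.coeff_evalFun_eq f h, coeff_aeval_eq _ h, PowerSeries.coeff_trunc, if_pos (by omega)]

theorem exists_bound_of_finite {ι : Type*} {s : Set ι} (hs : s.Finite) {p : ι → ℕ → Prop}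
    (h : ∀ i, ∃ N₀, ∀ N, N₀ ≤ N → p i N) : ∃ N₀, ∀ N, N₀ ≤ N → ∀ i ∈ s, p i N := by
  choose n hn using h
  obtain ⟨b, hb⟩ := (hs.image n).bddAbove
  exact ⟨b, fun N hN i hi => hn i N ((hb ⟨i, hi, rfl⟩).trans hN)⟩

/-- Each coefficient of a product is computed by truncated series. -/
theorem PowersSummable.exists_trunc_mul_right (he : PowersSummable e) (K : A) :
    ∃ N₀ : ℕ, ∀ N, N₀ ≤ N → ∀ (f : PowerSeries ℚ) (y : CompletedHall A),
      (he.evalFun f * y).coeff (cls K) =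
        (Polynomial.aeval e (f.trunc N) * y).coeff (cls K) := by
  obtain ⟨N₀, h⟩ := exists_bound_of_finite (he.finite K)
    fun U => he.exists_trunc (cls (quot U))
  refine ⟨N₀, fun N hN f y => ?_⟩
  rw [CompletedHall.coeff_mul_cls, CompletedHall.coeff_mul_cls]
  refine finsum_congr fun U => ?_
  by_cases hU : ∃ n, (e ^ n).coeff (cls (quot U)) ≠ 0
  · rw [h N hN U hU f]
  · push Not at hU
    obtain ⟨n₀, h₀⟩ := he.coeff_pow (cls (quot U))
    rw [he.coeff_evalFun_eq f h₀, coeff_aeval_eq _ h₀, hU, mul_zero, mul_zero]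

theorem PowersSummable.exists_trunc_mul_left (he : PowersSummable e) (K : A)
    (y : CompletedHall A) :
    ∃ N₀ : ℕ, ∀ N, N₀ ≤ N → ∀ f : PowerSeries ℚ,
      (y * he.evalFun f).coeff (cls K) =
        (y * Polynomial.aeval e (f.trunc N)).coeff (cls K) := by
  obtain ⟨N₀, h⟩ := exists_bound_of_finite (y.locallyFinite K)
    fun U => he.exists_trunc (cls (U : A))
  refine ⟨N₀, fun N hN f => ?_⟩
  rw [CompletedHall.coeff_mul_cls, CompletedHall.coeff_mul_cls]
  refine finsum_congr fun U => ?_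
  by_cases hU : y.coeff (cls (quot U)) = 0
  · rw [hU, zero_mul, zero_mul]
  · rw [h N hN U hU f]

theorem PowersSummable.evalFun_coe (he : PowersSummable e) (p : Polynomial ℚ) :
    he.evalFun (p : PowerSeries ℚ) = Polynomial.aeval e p := by
  ext κ
  obtain ⟨n₀, h⟩ := he.coeff_pow κ
  rw [he.coeff_evalFun_eq _ h, coeff_aeval_eq _ h, Polynomial.coeff_coe]

/-- Evaluation of power series at `e` is a ring homomorphism. -/
noncomputable def PowersSummable.eval (he : PowersSummable e) :
    PowerSeries ℚ →+* CompletedHall A where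
  toFun := he.evalFun
  map_one' := by
    have := he.evalFun_coe 1
    rwa [Polynomial.coe_one, map_one] at this
  map_zero' := by
    have := he.evalFun_coe 0
    rwa [Polynomial.coe_zero, map_zero] at this
  map_add' f g := by
    ext κ
    obtain ⟨n₀, h⟩ := he.coeff_pow κ
    rw [CompletedHall.coeff_add, Pi.add_apply, he.coeff_evalFun_eq _ h, he.coeff_evalFun_eq _ h,
      he.coeff_evalFun_eq _ h, map_add, add_mul]
  map_mul' f g := by
    ext κ
    obtain ⟨K, rfl⟩ := exists_cls κ
    obtain ⟨n₀, h⟩ := he.coeff_pow (cls K)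
    obtain ⟨N₁, h₁⟩ := he.exists_trunc_mul_right K
    set N := max N₁ (n₀ + 1)
    obtain ⟨N₂, h₂⟩ := he.exists_trunc_mul_left K (Polynomial.aeval e (f.trunc N))
    set M := max N₂ (n₀ + 1)
    rw [h₁ N (le_max_left _ _), h₂ M (le_max_left _ _), ← map_mul, coeff_aeval_eq _ h,
      he.coeff_evalFun_eq _ h, PowerSeries.coeff_mul, Polynomial.coeff_mul]
    congr 1
    refine Finset.sum_congr rfl fun x hx => ?_
    have hx' := Finset.HasAntidiagonal.mem_antidiagonal.1 hx
    have hN : n₀ + 1 ≤ N := le_max_right _ _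
    have hM : n₀ + 1 ≤ M := le_max_right _ _
    rw [PowerSeries.coeff_trunc, PowerSeries.coeff_trunc, if_pos (by omega), if_pos (by omega)]

theorem PowersSummable.eval_apply (he : PowersSummable e) (f : PowerSeries ℚ) :
    he.eval f = he.evalFun f := rfl

theorem PowersSummable.eval_X (he : PowersSummable e) : he.eval PowerSeries.X = e := by
  rw [eval_apply, ← Polynomial.coe_X, he.evalFun_coe, Polynomial.aeval_X]

theorem PowersSummable.eval_C (he : PowersSummable e) (c : ℚ) :
    he.eval (PowerSeries.C c) = algebraMap ℚ _ c := by
  rw [eval_apply, ← Polynomial.coe_C, he.evalFun_coe, Polynomial.aeval_C]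

end SeriesEval

section QExponential

theorem qFactorial_zero (q : ℚ) : qFactorial q 0 = 1 := Finset.prod_range_zero _

theorem qFactorial_succ (q : ℚ) (n : ℕ) :
    qFactorial q (n + 1) = qFactorial q n * ∑ i ∈ Finset.range (n + 1), q ^ i :=
  Finset.prod_range_succ _ _

/-- The `q`-exponential series `∑ n, (q ^ m X) ^ n / [n]_q!`. -/
noncomputable def qExp (q : ℚ) (m : ℤ) : PowerSeries ℚ :=
  PowerSeries.mk fun n => (qFactorial q n)⁻¹ * (q ^ m) ^ n

theorem isUnit_qExp (q : ℚ) (m : ℤ) : IsUnit (qExp q m) := by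
  rw [PowerSeries.isUnit_iff_constantCoeff, ← PowerSeries.coeff_zero_eq_constantCoeff_apply, qExp,
    PowerSeries.coeff_mk, qFactorial_zero]
  simp

theorem qExp_succ {q : ℚ} (hq : 0 < q) (m : ℤ) :
    qExp q (m + 1) = (1 + PowerSeries.C ((q - 1) * q ^ m) * PowerSeries.X) * qExp q m := by
  ext n
  rw [add_mul, one_mul, map_add, mul_assoc, PowerSeries.coeff_C_mul]
  rcases n with _ | n
  · simp [qExp]
  · rw [PowerSeries.coeff_succ_X_mul, qExp, qExp, PowerSeries.coeff_mk, PowerSeries.coeff_mk,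
      PowerSeries.coeff_mk, qFactorial_succ, zpow_add_one₀ hq.ne']
    have h1 := (qFactorial_pos hq n).ne'
    have h2 : ∑ i ∈ Finset.range (n + 1), q ^ i ≠ 0 :=
      (Finset.sum_pos (fun i _ => pow_pos hq i) ⟨0, by simp⟩).ne'
    have h3 := geom_sum_mul q (n + 1)
    have h4 : q ^ (n + 1) = (∑ i ∈ Finset.range (n + 1), q ^ i) * (q - 1) + 1 := by
      rw [h3]; ring
    rw [mul_pow, h4, pow_succ (q ^ m) n]
    field_simp
    ring

/-- The `q`-commutation rule behind conjugation by `q`-exponentials: left multiplication by `e` is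
the sum of the operators `x k * e ^ l ↦ x (k + 1) * e ^ l` and
`x k * e ^ l ↦ q ^ (m + k) • x k * e ^ (l + 1)`, which commute up to a factor `q`. The formula is
the resulting `q`-binomial theorem. -/
theorem qBinomial {R : Type*} [Ring R] [Algebra ℚ R] {q : ℚ} (hq : 0 < q) (m : ℤ) (e : R)
    (x : ℕ → R) (h : ∀ k : ℕ, e * x k = x (k + 1) + q ^ (m + k) • (x k * e)) (n : ℕ) :
    (qFactorial q n)⁻¹ • (e ^ n * x 0) = ∑ p ∈ Finset.HasAntidiagonal.antidiagonal n,
      ((qFactorial q p.1)⁻¹ * ((qFactorial q p.2)⁻¹ * (q ^ m) ^ p.2)) • (x p.1 * e ^ p.2) := by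
  set c : ℕ → ℚ := fun n => ∑ i ∈ Finset.range n, q ^ i with hc
  have hc0 : ∀ n, c (n + 1) ≠ 0 := fun n =>
    (Finset.sum_pos (fun i _ => pow_pos hq i) ⟨0, by simp⟩).ne'
  have hf : ∀ n, (qFactorial q n)⁻¹ = c (n + 1) * (qFactorial q (n + 1))⁻¹ := fun n => by
    rw [qFactorial_succ, mul_inv, mul_left_comm, mul_inv_cancel₀ (hc0 n), mul_one]
  set T : ℕ × ℕ → R := fun p =>
    ((qFactorial q p.1)⁻¹ * ((qFactorial q p.2)⁻¹ * (q ^ m) ^ p.2)) • (x p.1 * e ^ p.2) with hT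
  induction n with
  | zero => simp [qFactorial_zero, hT]
  | succ n ih =>
    have h1 : ∀ p : ℕ × ℕ, e * T p = c (p.1 + 1) • T (p.1 + 1, p.2) +
        (q ^ p.1 * c (p.2 + 1)) • T (p.1, p.2 + 1) := by
      rintro ⟨k, l⟩
      simp only [hT]
      rw [mul_smul_comm, ← mul_assoc e, h, add_mul, smul_add, smul_smul, smul_smul,
        smul_mul_assoc, smul_smul, mul_assoc (x k), ← pow_succ']
      congr 2
      · rw [hf k]; ring
      · rw [hf l, zpow_add₀ hq.ne', zpow_natCast]; ring
    have h2 : c (n + 1) • ∑ p ∈ Finset.HasAntidiagonal.antidiagonal (n + 1), T p =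
        e * ∑ p ∈ Finset.HasAntidiagonal.antidiagonal n, T p := by
      have h3 : ∀ p ∈ Finset.HasAntidiagonal.antidiagonal (n + 1),
          c (n + 1) • T p = c p.1 • T p + (q ^ p.1 * c p.2) • T p := by
        intro p hp
        rw [← add_smul, ← Finset.HasAntidiagonal.mem_antidiagonal.1 hp]
        congr 1
        simp only [hc]
        rw [Finset.sum_range_add, Finset.mul_sum]
        simp only [pow_add]
      rw [Finset.smul_sum, Finset.sum_congr rfl h3, Finset.sum_add_distrib, Finset.mul_sum,
        Finset.sum_congr rfl fun p _ => h1 p, Finset.sum_add_distrib]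
      congr 1
      · rw [Finset.Nat.sum_antidiagonal_succ]
        simp [hc]
      · rw [Finset.Nat.sum_antidiagonal_succ']
        simp [hc]
    have h4 : (qFactorial q (n + 1))⁻¹ • (e ^ (n + 1) * x 0) =
        (c (n + 1))⁻¹ • (e * ((qFactorial q n)⁻¹ • (e ^ n * x 0))) := by
      rw [mul_smul_comm, smul_smul, ← mul_assoc, ← pow_succ', hf n,
        inv_mul_cancel_left₀ (hc0 n)]
    rw [h4, ih, ← h2, smul_smul, inv_mul_cancel₀ (hc0 n), one_smul]

end QExponential

section ExpConj

variable {A : Type u} [Category.{v} A] [Abelian A] {e : CompletedHall A}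

theorem aeval_trunc_qExp {R : Type*} [Ring R] [Algebra ℚ R] (e : R) (q : ℚ) (m : ℤ) (N : ℕ) :
    Polynomial.aeval e ((qExp q m).trunc N) =
      ∑ l ∈ Finset.range N, ((qFactorial q l)⁻¹ * (q ^ m) ^ l) • e ^ l := by
  rw [PowerSeries.trunc_apply, map_sum, Nat.Ico_zero_eq_range]
  refine Finset.sum_congr rfl fun l _ => ?_
  rw [Polynomial.aeval_monomial, ← Algebra.smul_def, qExp, PowerSeries.coeff_mk]

theorem aeval_trunc_qExp_mul {R : Type*} [Ring R] [Algebra ℚ R] {q : ℚ} (hq : 0 < q) (m : ℤ)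
    (e : R) (x : ℕ → R) (h : ∀ k : ℕ, e * x k = x (k + 1) + q ^ (m + k) • (x k * e)) (N : ℕ) :
    Polynomial.aeval e ((qExp q 0).trunc N) * x 0 =
      ∑ k ∈ Finset.range N, (qFactorial q k)⁻¹ •
        (x k * Polynomial.aeval e ((qExp q m).trunc (N - k))) := by
  simp only [aeval_trunc_qExp, zpow_zero, one_pow, mul_one]
  rw [Finset.sum_mul, Finset.sum_congr rfl fun n _ => (smul_mul_assoc _ _ _).trans
    ((qBinomial hq m e x h n).trans (Finset.Nat.sum_antidiagonal_eq_sum_range_succ (fun k l =>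
      ((qFactorial q k)⁻¹ * ((qFactorial q l)⁻¹ * (q ^ m) ^ l)) • (x k * e ^ l)) n)),
    Finset.sum_range_diag_flip N fun k l =>
      ((qFactorial q k)⁻¹ * ((qFactorial q l)⁻¹ * (q ^ m) ^ l)) • (x k * e ^ l)]
  refine Finset.sum_congr rfl fun k _ => ?_
  rw [Finset.mul_sum, Finset.smul_sum]
  refine Finset.sum_congr rfl fun l _ => ?_
  rw [mul_smul_comm, smul_smul]

theorem sum_range_eq_of_vanishing {M : Type*} [AddCommMonoid M] {d N : ℕ} (hN : d ≤ N)
    {f g : ℕ → M} (h : ∀ k < d, f k = g k) (h0 : ∀ k, d ≤ k → f k = 0) :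
    ∑ k ∈ Finset.range N, f k = ∑ k ∈ Finset.range d, g k := by
  rw [← Finset.sum_subset (Finset.range_mono hN) fun k _ hk =>
    h0 k (by simpa using hk)]
  exact Finset.sum_congr rfl fun k hk => h k (Finset.mem_range.1 hk)

/-- The limit of the formulas `qBinomial`, for a sequence of iterated `q`-commutators that is
eventually zero. -/
theorem PowersSummable.eval_qExp_mul (he : PowersSummable e) {q : ℚ} (hq : 0 < q) (m : ℤ)
    (x : ℕ → CompletedHall A) (d : ℕ) (hx : ∀ k, d ≤ k → x k = 0)
    (h : ∀ k : ℕ, e * x k = x (k + 1) + q ^ (m + k) • (x k * e)) :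
    he.eval (qExp q 0) * x 0 =
      (∑ k ∈ Finset.range d, (qFactorial q k)⁻¹ • x k) * he.eval (qExp q m) := by
  ext κ
  obtain ⟨K, rfl⟩ := exists_cls κ
  obtain ⟨N₁, h₁⟩ := he.exists_trunc_mul_right K
  obtain ⟨N₂, h₂⟩ := exists_bound_of_finite (Set.finite_Iio d)
    fun k => he.exists_trunc_mul_left K (x k)
  have hN : N₁ ≤ N₁ + N₂ + d := by omega
  rw [eval_apply, eval_apply, h₁ _ hN, aeval_trunc_qExp_mul hq m e x h, Finset.sum_mul, coeff_sum,
    coeff_sum]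
  refine sum_range_eq_of_vanishing (by omega) (fun k hk => ?_) fun k hk => ?_
  · rw [smul_mul_assoc, CompletedHall.coeff_smul, CompletedHall.coeff_smul, Pi.smul_apply,
      Pi.smul_apply, h₂ (N₁ + N₂ + d - k) (by omega) k hk]
  · rw [hx k hk, zero_mul, smul_zero, CompletedHall.coeff_zero, Pi.zero_apply]

/-- The mirror image of `PowersSummable.eval_qExp_mul`. -/
theorem PowersSummable.mul_eval_qExp (he : PowersSummable e) {q : ℚ} (hq : 0 < q) (m : ℤ)
    (x : ℕ → CompletedHall A) (d : ℕ) (hx : ∀ k, d ≤ k → x k = 0)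
    (h : ∀ k : ℕ, x k * e = x (k + 1) + q ^ (m + k) • (e * x k)) :
    x 0 * he.eval (qExp q 0) =
      he.eval (qExp q m) * ∑ k ∈ Finset.range d, (qFactorial q k)⁻¹ • x k := by
  -- The truncated formula is `aeval_trunc_qExp_mul` in the opposite algebra.
  have key : ∀ N, x 0 * Polynomial.aeval e ((qExp q 0).trunc N) =
      ∑ k ∈ Finset.range N, (qFactorial q k)⁻¹ •
        (Polynomial.aeval e ((qExp q m).trunc (N - k)) * x k) := by
    intro N
    have h' := aeval_trunc_qExp_mul hq m (MulOpposite.op e) (fun k => MulOpposite.op (x k))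
      (fun k => congrArg MulOpposite.op (h k)) N
    simpa [aeval_trunc_qExp] using congrArg MulOpposite.unop h'
  ext κ
  obtain ⟨K, rfl⟩ := exists_cls κ
  obtain ⟨N₁, h₁⟩ := he.exists_trunc_mul_left K (x 0)
  obtain ⟨N₂, h₂⟩ := he.exists_trunc_mul_right K
  have hN : N₁ ≤ N₁ + N₂ + d := by omega
  rw [eval_apply, eval_apply, h₁ _ hN, key, Finset.mul_sum, coeff_sum, coeff_sum]
  refine sum_range_eq_of_vanishing (by omega) (fun k hk => ?_) fun k hk => ?_
  · rw [mul_smul_comm, CompletedHall.coeff_smul, CompletedHall.coeff_smul, Pi.smul_apply,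
      Pi.smul_apply, h₂ (N₁ + N₂ + d - k) (by omega)]
  · rw [hx k hk, mul_zero, smul_zero, CompletedHall.coeff_zero, Pi.zero_apply]

end ExpConj

/-! ### Weight spaces of the Hall algebra -/

section ExpUnit

variable {A : Type u} [Category.{v} A] [Abelian A] {e : CompletedHall A}

theorem sum_range_succ_mem_iSup {B : Type*} [AddCommGroup B] [Module ℚ B]
    {W : ℤ → ℕ → Submodule ℚ B} (hmono : ∀ m, Monotone (W m)) {d : ℕ} (x : ℕ → B) (c : ℕ → ℚ)
    (f : ℕ → ℤ) (hx : ∀ k, x k ∈ W (f k) (d + 1 - k)) :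
    ∑ k ∈ Finset.range d, c (k + 1) • x (k + 1) ∈ ⨆ m, W m d :=
  sum_mem fun k _ => Submodule.smul_mem _ _
    (Submodule.mem_iSup_of_mem (f (k + 1)) (hmono _ (by omega) (hx (k + 1))))

/-- The iterated `q`-commutators of `x₀` lie in spaces of decreasing index `d`, so they vanish after
`d` steps, and `PowersSummable.eval_qExp_mul` applies to them. -/
theorem PowersSummable.exists_eval_qExp_mul (he : PowersSummable e) {q : ℚ} (hq : 0 < q)
    {W : ℤ → ℕ → Submodule ℚ (CompletedHall A)} (hmono : ∀ m, Monotone (W m))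
    (hW0 : ∀ m, W m 0 = ⊥)
    (hcomm : ∀ m d, ∀ x ∈ W m (d + 1), e * x - q ^ m • (x * e) ∈ W (m + 1) d)
    {m : ℤ} {d : ℕ} {x₀ : CompletedHall A} (hx₀ : x₀ ∈ W m (d + 1)) :
    ∃ y ∈ ⨆ m, W m d, he.eval (qExp q 0) * x₀ = (x₀ + y) * he.eval (qExp q m) := by
  let x : ℕ → CompletedHall A := fun k =>
    Nat.rec x₀ (fun k z => e * z - q ^ (m + k) • (z * e)) k
  have hs : ∀ k : ℕ, x (k + 1) = e * x k - q ^ (m + k) • (x k * e) := fun _ => rfl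
  have hx : ∀ k : ℕ, x k ∈ W (m + k) (d + 1 - k) := by
    intro k
    induction k with
    | zero =>
      rw [Nat.cast_zero, add_zero]
      exact hx₀
    | succ k ih =>
      rw [hs]
      rcases Nat.lt_or_ge k (d + 1) with hk | hk
      · rw [show d + 1 - k = (d + 1 - (k + 1)) + 1 by omega] at ih
        simpa [add_assoc] using hcomm _ _ _ ih
      · rw [Nat.sub_eq_zero_of_le hk, hW0, Submodule.mem_bot] at ih
        rw [ih, mul_zero, zero_mul, smul_zero, sub_zero]
        exact zero_mem _
  have hx0 : ∀ k, d + 1 ≤ k → x k = 0 := by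
    intro k hk
    have := hx k
    rwa [Nat.sub_eq_zero_of_le hk, hW0, Submodule.mem_bot] at this
  refine ⟨_, sum_range_succ_mem_iSup hmono x (fun k => (qFactorial q k)⁻¹) _ hx, ?_⟩
  rw [show x₀ = x 0 from rfl, he.eval_qExp_mul hq m x (d + 1) hx0 (fun k => by rw [hs]; abel),
    Finset.sum_range_succ', qFactorial_zero, inv_one, one_smul, add_comm]

/-- The version of `PowersSummable.exists_eval_qExp_mul` for commutators that lower the weight. -/
theorem PowersSummable.exists_mul_eval_qExp (he : PowersSummable e) {q : ℚ} (hq : 0 < q)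
    {W : ℤ → ℕ → Submodule ℚ (CompletedHall A)} (hmono : ∀ m, Monotone (W m))
    (hW0 : ∀ m, W m 0 = ⊥)
    (hcomm : ∀ m d, ∀ x ∈ W m (d + 1), e * x - q ^ m • (x * e) ∈ W (m + -1) d)
    {m : ℤ} {d : ℕ} {x₀ : CompletedHall A} (hx₀ : x₀ ∈ W m (d + 1)) :
    ∃ y ∈ ⨆ m, W m d, x₀ * he.eval (qExp q 0) = he.eval (qExp q (-m)) * (x₀ + y) := by
  let x : ℕ → CompletedHall A := fun k =>
    Nat.rec x₀ (fun k z => z * e - q ^ (-m + k) • (e * z)) k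
  have hs : ∀ k : ℕ, x (k + 1) = x k * e - q ^ (-m + k) • (e * x k) := fun _ => rfl
  have hx : ∀ k : ℕ, x k ∈ W (m - k) (d + 1 - k) := by
    intro k
    induction k with
    | zero =>
      rw [Nat.cast_zero, sub_zero]
      exact hx₀
    | succ k ih =>
      rcases Nat.lt_or_ge k (d + 1) with hk | hk
      · rw [show d + 1 - k = (d + 1 - (k + 1)) + 1 by omega] at ih
        have h1 := Submodule.smul_mem _ (-(q ^ (-m + k : ℤ))) (hcomm _ _ _ ih)
        have h2 : -(q ^ (-m + k : ℤ)) • (e * x k - q ^ (m - k : ℤ) • (x k * e)) = x (k + 1) := by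
          rw [hs, smul_sub, smul_smul, neg_mul, ← zpow_add₀ hq.ne',
            show -m + (k : ℤ) + (m - k) = 0 by ring, zpow_zero, neg_smul, neg_smul, one_smul]
          abel
        rw [h2] at h1
        rwa [show m - ((k + 1 : ℕ) : ℤ) = m - k + -1 by push_cast; ring]
      · rw [Nat.sub_eq_zero_of_le hk, hW0, Submodule.mem_bot] at ih
        rw [hs, ih, mul_zero, zero_mul, smul_zero, sub_zero]
        exact zero_mem _
  have hx0 : ∀ k, d + 1 ≤ k → x k = 0 := by
    intro k hk
    have := hx k
    rwa [Nat.sub_eq_zero_of_le hk, hW0, Submodule.mem_bot] at this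
  refine ⟨_, sum_range_succ_mem_iSup hmono x (fun k => (qFactorial q k)⁻¹) _ hx, ?_⟩
  rw [show x₀ = x 0 from rfl, he.mul_eval_qExp hq (-m) x (d + 1) hx0 (fun k => by rw [hs]; abel),
    Finset.sum_range_succ', qFactorial_zero, inv_one, one_smul, add_comm]

/-- The unit `exp_q(q ^ m e)` of the completed Hall algebra. -/
noncomputable def expUnit {e : CompletedHall A} (he : PowersSummable e) (q : ℚ) (m : ℤ) :
    (CompletedHall A)ˣ :=
  Units.map he.eval.toMonoidHom (isUnit_qExp q m).unit

theorem coe_expUnit {e : CompletedHall A} (he : PowersSummable e) (q : ℚ) (m : ℤ) :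
    (expUnit he q m : CompletedHall A) = he.eval (qExp q m) := rfl

theorem exists_shortExact_of_subobject {K M N : A} (U : Subobject K) (hN : Nonempty ((U : A) ≅ N))
    (hM : Nonempty (quot U ≅ M)) :
    ∃ (f : N ⟶ K) (g : K ⟶ M) (zero : f ≫ g = 0), (ShortComplex.mk f g zero).ShortExact ∧
      ((∃ s, s ≫ g = 𝟙 M) → ∃ s, s ≫ cokernel.π U.arrow = 𝟙 (quot U)) := by
  obtain ⟨i⟩ := hN
  obtain ⟨j⟩ := hM
  have h : (ShortComplex.mk U.arrow (cokernel.π U.arrow) (cokernel.condition _)).ShortExact :=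
    { exact := ShortComplex.exact_cokernel _ }
  have zero : (i.inv ≫ U.arrow) ≫ (cokernel.π U.arrow ≫ j.hom) = 0 := by
    rw [Category.assoc, cokernel.condition_assoc, zero_comp, comp_zero]
  refine ⟨i.inv ≫ U.arrow, cokernel.π U.arrow ≫ j.hom, zero,
    ShortComplex.shortExact_of_iso (ShortComplex.isoMk i (Iso.refl K) j) h, ?_⟩
  rintro ⟨s, hs⟩
  refine ⟨j.hom ≫ s, ?_⟩
  rw [← cancel_mono j.hom, Category.assoc, Category.assoc, hs, Category.comp_id, Category.id_comp]

end ExpUnit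

section Weights

variable {A : Type u} [Category.{v} A] [Abelian A] [HomFinite A] {E : A}

theorem IsBrick.powersSummable [HasExt.{w} A] (hE : IsBrick E)
    (hExt : Subsingleton (Ext.{w} E E 1)) : PowersSummable (basisElt E) where
  coeff_pow := hE.exists_forall_coeff_pow_eq_zero hExt
  finite K := (finite_quot_addClosure E K).subset fun U ⟨_, hn⟩ =>
    ⟨quot U, rfl, hE.addClosure_of_coeff_pow_ne_zero hExt hn⟩

theorem coe_expUnit_zero [HasExt.{w} A] (hE : IsBrick E) (hExt : Subsingleton (Ext.{w} E E 1)) :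
    (expUnit (hE.powersSummable hExt) (qE E) 0 : CompletedHall A) = expAdd E := by
  ext κ
  rw [coe_expUnit, PowersSummable.eval_apply, PowersSummable.coeff_evalFun,
    hE.coeff_expAdd hExt]
  refine finsum_congr fun n => ?_
  rw [qExp, PowerSeries.coeff_mk, zpow_zero, one_pow, mul_one, div_eq_inv_mul]

theorem mem_span_basisElt {x : CompletedHall A} (hx : {κ | x.coeff κ ≠ 0}.Finite) (T : A → Prop)
    (hT : ∀ M : A, x.coeff (cls M) ≠ 0 → T M) :
    x ∈ Submodule.span ℚ (basisElt '' {M | T M}) := by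
  classical
  have hout : ∀ κ : IsoClass A, cls (Quotient.out κ) = κ := fun κ => Quotient.out_eq κ
  have h : x = ∑ κ ∈ hx.toFinset, x.coeff κ • basisElt (Quotient.out κ) := by
    ext κ
    rw [coeff_sum]
    simp only [CompletedHall.coeff_smul, Pi.smul_apply, coeff_basisElt, hout, smul_eq_mul,
      mul_ite, mul_one, mul_zero]
    rw [Finset.sum_ite_eq]
    split_ifs with hκ
    · rfl
    · by_contra hc
      exact hκ (hx.mem_toFinset.2 hc)
  rw [h]
  refine sum_mem fun κ hκ => Submodule.smul_mem _ _ (Submodule.subset_span ⟨_, hT _ ?_, rfl⟩)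
  rw [hout]
  exact hx.mem_toFinset.1 hκ

/-- The span of the classes `[C]` with `C` in `P`, with `|Hom(C, E)| = q_E ^ m |Hom(E, C)|`, and
with `δ C ≤ d`. In the applications `δ C` is the number of elements of `Ext¹(E, C)` or of
`Ext¹(C, E)`; in particular it is positive, and the span is zero for `d = 0`. -/
noncomputable def weightSpace (P : ObjectProperty A) (E : A) (δ : A → ℕ) (m : ℤ) (d : ℕ) :
    Submodule ℚ (CompletedHall A) :=
  Submodule.span ℚ (basisElt '' {C | P C ∧
    (Nat.card (C ⟶ E) : ℚ) = qE E ^ m * Nat.card (E ⟶ C) ∧ δ C ≤ d})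

theorem IsBrick.exists_weight (hE : IsBrick E) (C : A) :
    ∃ m : ℤ, (Nat.card (C ⟶ E) : ℚ) = qE E ^ m * Nat.card (E ⟶ C) := by
  obtain ⟨⟨a, ha⟩, b, hb⟩ := hE.card_hom C
  refine ⟨a - b, ?_⟩
  rw [ha, hb, Nat.cast_pow, Nat.cast_pow, ← qE, ← zpow_natCast, ← zpow_natCast,
    ← zpow_add₀ hE.qE_pos.ne', sub_add_cancel]

/-- Only non-split extensions contribute to the `q`-commutator of `[E]` and `[C]`. -/
theorem coeff_commutator_eq_zero_of_split {C K : A} {c : ℚ}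
    (hC : (Nat.card (C ⟶ E) : ℚ) = c * Nat.card (E ⟶ C))
    (h : ∀ U : Subobject K, Nonempty ((U : A) ≅ C) → Nonempty (quot U ≅ E) →
      ∃ s, s ≫ cokernel.π U.arrow = 𝟙 (quot U))
    (h' : ∀ U : Subobject K, Nonempty ((U : A) ≅ E) → Nonempty (quot U ≅ C) →
      ∃ s, s ≫ cokernel.π U.arrow = 𝟙 (quot U)) :
    (basisElt E * basisElt C - c • (basisElt C * basisElt E)).coeff (cls K) = 0 := by
  have h1 := coeff_mul_comm_of_split E C K h h'
  rw [hC, ← mul_assoc] at h1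
  have h2 : (Nat.card (E ⟶ C) : ℚ) ≠ 0 := Nat.cast_ne_zero.2 Nat.card_pos.ne'
  rw [sub_eq_add_neg, ← neg_smul, CompletedHall.coeff_add, Pi.add_apply,
    CompletedHall.coeff_smul, Pi.smul_apply, smul_eq_mul, mul_right_cancel₀ h2 h1]
  ring

variable [HasExt.{w} A] [ExtFinite.{w} A]
variable (P : ObjectProperty A) [P.IsClosedUnderIsomorphisms] [P.ContainsZero]
  [P.IsClosedUnderExtensions]

theorem basisElt_mem_hallSubalgebra {M : A} (hM : P M) : basisElt M ∈ hallSubalgebra.{w} P := by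
  classical
  have key : ∀ κ, (basisElt M).coeff κ ≠ 0 → κ = cls M := fun κ hκ => by
    by_contra hc
    exact hκ (if_neg hc)
  refine ⟨(Set.finite_singleton (cls M)).subset key, fun N hN => ?_⟩
  obtain ⟨i⟩ := cls_eq_iff.1 (key _ hN)
  exact P.prop_of_iso i.symm hM

/-- It suffices to find a positive integer `δ C` for each object `C`, such that the `q`-commutator
of `[E]` and `[C]` involves only objects `K` with `δ K < δ C` and with the weight shifted by
`±1`. -/
theorem IsBrick.conjugationDefinesAut_of_weightSpace (hE : IsBrick E)
    (hExt : Subsingleton (Ext.{w} E E 1)) (hPE : P E) (δ : A → ℕ) (hδ : ∀ C, 0 < δ C) (ε : ℤ)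
    (hε : ε = 1 ∨ ε = -1)
    (hcomm : ∀ (m : ℤ) (d : ℕ) (C : A), P C →
      (Nat.card (C ⟶ E) : ℚ) = qE E ^ m * Nat.card (E ⟶ C) → δ C ≤ d + 1 →
      ∀ K : A, (basisElt E * basisElt C - qE E ^ m • (basisElt C * basisElt E)).coeff (cls K) ≠ 0 →
        (Nat.card (K ⟶ E) : ℚ) = qE E ^ (m + ε) * Nat.card (E ⟶ K) ∧ δ K ≤ d) :
    ConjugationDefinesAut (hallSubalgebra.{w} P) (oreSubmonoid E)
      (expUnit (hE.powersSummable hExt) (qE E) 0) := by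
  set he := hE.powersSummable hExt
  have hq := hE.qE_pos
  have heH := basisElt_mem_hallSubalgebra.{w} P hPE
  have hWH : ∀ m d, weightSpace P E δ m d ≤ (hallSubalgebra.{w} P).toSubmodule := by
    intro m d
    refine Submodule.span_le.2 ?_
    rintro _ ⟨C, hC, rfl⟩
    exact basisElt_mem_hallSubalgebra P hC.1
  have hW0 : ∀ m, weightSpace P E δ m 0 = ⊥ := by
    intro m
    refine (Submodule.span_eq_bot.2 ?_)
    rintro _ ⟨C, hC, rfl⟩
    exact absurd hC.2.2 (hδ C).not_ge
  have hmono : ∀ m, Monotone (weightSpace P E δ m) := fun m d d' h =>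
    Submodule.span_mono (Set.image_mono fun C hC => ⟨hC.1, hC.2.1, hC.2.2.trans h⟩)
  have hgen : (hallSubalgebra.{w} P).toSubmodule ≤ ⨆ i : ℤ × ℕ, weightSpace P E δ i.1 i.2 := by
    intro x hx
    refine Submodule.span_le.2 ?_ (mem_span_basisElt hx.1 P hx.2)
    rintro _ ⟨C, hC, rfl⟩
    obtain ⟨m, hm⟩ := hE.exists_weight C
    exact Submodule.mem_iSup_of_mem (m, δ C) (Submodule.subset_span ⟨C, ⟨hC, hm, le_rfl⟩, rfl⟩)
  have hcomm' : ∀ m d, ∀ x ∈ weightSpace P E δ m (d + 1),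
      basisElt E * x - qE E ^ m • (x * basisElt E) ∈ weightSpace P E δ (m + ε) d := by
    intro m d x hx
    induction hx using Submodule.span_induction with
    | mem x hx =>
      obtain ⟨C, ⟨hPC, hC, hd⟩, rfl⟩ := hx
      have hH : basisElt E * basisElt C - qE E ^ m • (basisElt C * basisElt E) ∈
          hallSubalgebra.{w} P :=
        have hC := basisElt_mem_hallSubalgebra.{w} P hPC
        sub_mem (mul_mem heH hC) (Subalgebra.smul_mem _ (mul_mem hC heH) _)
      exact mem_span_basisElt hH.1 _ fun K hK => ⟨hH.2 K hK, hcomm m d C hPC hC hd K hK⟩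
    | zero => simp
    | add x y _ _ hx hy =>
      convert add_mem hx hy using 1
      rw [mul_add, add_mul, smul_add]
      abel
    | smul c x _ hx =>
      convert Submodule.smul_mem _ c hx using 1
      rw [mul_smul_comm, smul_mul_assoc, smul_comm _ c, smul_sub]
  refine conjugationDefinesAut_of_weights (hallSubalgebra.{w} P) (basisElt E) (qE E) hq.ne' ε heH
    (weightSpace P E δ) hWH hW0 hcomm' hgen (oreSubmonoid E) rfl (expUnit he (qE E))
    (fun m => ?_) (fun m => ?_) ?_
  · rw [coe_expUnit, coe_expUnit, qExp_succ hq, map_mul, map_add, map_one, map_mul, he.eval_X,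
      he.eval_C, Algebra.smul_def]
  · have h := congrArg he.eval (mul_comm (qExp (qE E) m) PowerSeries.X)
    rwa [map_mul, map_mul, he.eval_X] at h
  · rcases hε with rfl | rfl
    · exact Or.inl fun m d x hx => he.exists_eval_qExp_mul hq hmono hW0 hcomm' hx
    · exact Or.inr fun m d x hx => he.exists_mul_eval_qExp hq hmono hW0 hcomm' hx

/-- For objects `C` with `Ext¹(C, E) = 0`, the size of `Ext¹(E, C)` decreases in `q`-commutators. -/
theorem IsBrick.conjugationDefinesAut_left (hE : IsBrick E)
    (hExt : Subsingleton (Ext.{w} E E 1)) (hPE : P E)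
    (hP : ∀ C, P C → Subsingleton (Ext.{w} C E 1)) :
    ConjugationDefinesAut (hallSubalgebra.{w} P) (oreSubmonoid E)
      (expUnit (hE.powersSummable hExt) (qE E) 0) := by
  refine hE.conjugationDefinesAut_of_weightSpace P hExt hPE (fun C => Nat.card (Ext.{w} E C 1))
    (fun C => Nat.card_pos) 1 (Or.inl rfl) fun m d C hPC hC hd K hK => ?_
  have := hP C hPC
  by_contra hc
  refine hK (coeff_commutator_eq_zero_of_split hC (fun U h₁ h₃ => ?_) fun U h₁ h₃ => ?_)
  · obtain ⟨f, g, zero, h, hs⟩ := exists_shortExact_of_subobject U h₁ h₃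
    by_contra hns
    obtain ⟨e1, e2, e3⟩ := hE.nonsplit_extension_left.{w} h fun h' => hns (hs h')
    refine hc ⟨?_, by omega⟩
    rw [e1, e2, Nat.cast_mul, hC, ← qE, zpow_add_one₀ hE.qE_pos.ne']
    ring
  · obtain ⟨f, g, zero, h, hs⟩ := exists_shortExact_of_subobject U h₁ h₃
    exact hs (exists_lift_of_subsingleton_ext.{w} h _)

/-- For objects `C` with `Ext¹(E, C) = 0`, the size of `Ext¹(C, E)` decreases in `q`-commutators. -/
theorem IsBrick.conjugationDefinesAut_right (hE : IsBrick E)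
    (hExt : Subsingleton (Ext.{w} E E 1)) (hPE : P E)
    (hP : ∀ C, P C → Subsingleton (Ext.{w} E C 1)) :
    ConjugationDefinesAut (hallSubalgebra.{w} P) (oreSubmonoid E)
      (expUnit (hE.powersSummable hExt) (qE E) 0) := by
  refine hE.conjugationDefinesAut_of_weightSpace P hExt hPE (fun C => Nat.card (Ext.{w} C E 1))
    (fun C => Nat.card_pos) (-1) (Or.inr rfl) fun m d C hPC hC hd K hK => ?_
  have := hP C hPC
  by_contra hc
  refine hK (coeff_commutator_eq_zero_of_split hC (fun U h₁ h₃ => ?_) fun U h₁ h₃ => ?_)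
  · obtain ⟨f, g, zero, h, hs⟩ := exists_shortExact_of_subobject U h₁ h₃
    exact hs (exists_lift_of_subsingleton_ext.{w} h _)
  · obtain ⟨f, g, zero, h, hs⟩ := exists_shortExact_of_subobject U h₁ h₃
    by_contra hns
    obtain ⟨e1, e2, e3⟩ := hE.nonsplit_extension_right.{w} h fun h' => hns (hs h')
    refine hc ⟨?_, by omega⟩
    rw [e1, e2, Nat.cast_mul, hC, ← qE, ← mul_assoc, ← zpow_add_one₀ hE.qE_pos.ne',
      neg_add_cancel_right]

end Weights

end HallAlgebra

theorem mainTheorem1 {A : Type u} [Category.{v} A] [Abelian A] [HasExt.{w} A]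
    [HallAlgebra.HomFinite A] [HallAlgebra.ExtFinite.{w} A]
    (E : A) (hE : HallAlgebra.IsBrick E) (hExt : Subsingleton (Ext.{w} E E 1)) :
    ∃ u : (HallAlgebra.CompletedHall A)ˣ,
      (u : HallAlgebra.CompletedHall A) = HallAlgebra.expAdd E ∧
      (∀ κ : HallAlgebra.IsoClass A,
        {n : ℕ | (HallAlgebra.basisElt E ^ n).coeff κ ≠ 0}.Finite ∧
        (HallAlgebra.expAdd E).coeff κ =
          ∑ᶠ n : ℕ, (HallAlgebra.basisElt E ^ n).coeff κ /
            HallAlgebra.qFactorial (HallAlgebra.qE E) n) ∧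
      HallAlgebra.ConjugationDefinesAut
        (HallAlgebra.hallSubalgebra.{w}
          (HallAlgebra.leftOrth.{w} (HallAlgebra.addClosure E)))
        (HallAlgebra.oreSubmonoid E) u ∧
      HallAlgebra.ConjugationDefinesAut
        (HallAlgebra.hallSubalgebra.{w}
          (HallAlgebra.rightOrth.{w} (HallAlgebra.addClosure E)))
        (HallAlgebra.oreSubmonoid E) u ∧
      (Projective E ∨ CategoryTheory.Injective E →
        HallAlgebra.ConjugationDefinesAut
          (HallAlgebra.hallSubalgebra.{w} (⊤ : ObjectProperty A))
          (HallAlgebra.oreSubmonoid E) u) := by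
  refine ⟨HallAlgebra.expUnit (hE.powersSummable hExt) (HallAlgebra.qE E) 0,
    HallAlgebra.coe_expUnit_zero hE hExt, fun κ => ⟨?_, hE.coeff_expAdd hExt κ⟩, ?_, ?_, ?_⟩
  · obtain ⟨n₀, h⟩ := hE.exists_forall_coeff_pow_eq_zero hExt κ
    refine (Set.finite_singleton n₀).subset fun n hn => ?_
    by_contra hc
    exact hn (h n hc)
  · exact hE.conjugationDefinesAut_left _ hExt (HallAlgebra.leftOrth_addClosure_iff.2 hExt)
      fun C => HallAlgebra.leftOrth_addClosure_iff.1
  · exact hE.conjugationDefinesAut_right _ hExt (HallAlgebra.rightOrth_addClosure_iff.2 hExt)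
      fun C => HallAlgebra.rightOrth_addClosure_iff.1
  · rintro (h | h)
    · exact hE.conjugationDefinesAut_right _ hExt trivial fun C _ =>
        subsingleton_of_forall_eq 0 fun x => Ext.eq_zero_of_projective x
    · exact hE.conjugationDefinesAut_left _ hExt trivial fun C _ =>
        subsingleton_of_forall_eq 0 fun x => Ext.eq_zero_of_injective x
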